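/- Let $k$ be a field of characteristic different from $2$, let $L/k$ be a finite Galois extension with $L\neq k$, and let $G=\mathrm{Gal}(L/k)$. Let $A(G)$ be the Burnside ring of $G$ (the Grothendieck ring of isomorphism classes of finite $G$-sets under disjoint union and cartesian product), and let $GW(k)$ be the Grothendieck–Witt ring of $k$ (the Grothendieck ring of isometry classes of nondegenerate quadratic forms over $k$ under orthogonal sum and tensor product). The Dress map $h_{L/k}\colon A(G)\to GW(k)$ is the ring homomorphism that sends $G/H$, for each subgroup $H\le G$, to the class of the trace form $x\mapsto \mathrm{tr}_{L^H/k}(x^2)$ on the fixed field $L^H$. Then $h_{L/k}$ is injective if and only if $L=k(\sqrt{\alpha})$ for some $\alpha\in k^\times$ that is not a sum of squares in $k$. -/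

import Mathlib

universe u v

open scoped TensorProduct

namespace GrothendieckRing

open Algebra

/-- The class of an element of a commutative additive monoid in its Grothendieck group. -/
def of (M : Type*) [AddCommMonoid M] : M →+ GrothendieckAddGroup M :=
  GrothendieckAddGroup.of

theorem hom_ext {M N : Type*} [AddCommMonoid M] [AddCommGroup N]
    {f g : GrothendieckAddGroup M →+ N} (h : ∀ s, f (of M s) = g (of M s)) : f = g :=
  GrothendieckAddGroup.lift.symm.injective (AddMonoidHom.ext h)

theorem lift_of {M N : Type*} [AddCommMonoid M] [AddCommGroup N] (f : M →+ N) (s : M) :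
    GrothendieckAddGroup.lift f (of M s) = f s :=
  DFunLike.congr_fun (GrothendieckAddGroup.lift.symm_apply_apply f) s

variable {S T : Type*} [CommSemiring S] [CommSemiring T]

/-- The biadditive extension of the multiplication of `S` to its Grothendieck group. -/
noncomputable def mulHom (S : Type*) [CommSemiring S] :
    GrothendieckAddGroup S →+ GrothendieckAddGroup S →+ GrothendieckAddGroup S :=
  GrothendieckAddGroup.lift
    { toFun := fun s => GrothendieckAddGroup.lift ((of S).comp (AddMonoidHom.mulLeft s))
      map_zero' := hom_ext fun t => by simp [lift_of]
      map_add' := fun s s' => hom_ext fun t => by simp [lift_of, add_mul] }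

theorem mulHom_of (s t : S) : mulHom S (of S s) (of S t) = of S (s * t) := by
  simp [mulHom, lift_of]

theorem mulHom_comm (x y : GrothendieckAddGroup S) : mulHom S x y = mulHom S y x := by
  have : mulHom S = (mulHom S).flip := hom_ext fun s => hom_ext fun t => by
    simp [mulHom_of, mul_comm]
  exact DFunLike.congr_fun (DFunLike.congr_fun this x) y

theorem mulHom_one (x : GrothendieckAddGroup S) : mulHom S (of S 1) x = x := by
  have : mulHom S (of S 1) = AddMonoidHom.id _ := hom_ext fun s => by
    simp [mulHom_of]
  exact DFunLike.congr_fun this x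

theorem mulHom_assoc (x y z : GrothendieckAddGroup S) :
    mulHom S (mulHom S x y) z = mulHom S x (mulHom S y z) := by
  have h1 (s t : S) : mulHom S (mulHom S (of S s) (of S t)) =
      (mulHom S (of S s)).comp (mulHom S (of S t)) := hom_ext fun u => by
    simp [mulHom_of, mul_assoc]
  have h2 (s : S) (z : GrothendieckAddGroup S) :
      ((mulHom S).flip z).comp (mulHom S (of S s)) =
      (mulHom S (of S s)).comp ((mulHom S).flip z) :=
    hom_ext fun t => DFunLike.congr_fun (h1 s t) z
  have h3 : ((mulHom S).flip z).comp ((mulHom S).flip y) =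
      (mulHom S).flip (mulHom S y z) :=
    hom_ext fun s => DFunLike.congr_fun (h2 s z) y
  exact DFunLike.congr_fun h3 x

/-- The Grothendieck ring of a commutative semiring: the Grothendieck group of its additive
monoid, with the multiplication that extends the one of the semiring. -/
noncomputable instance instCommRing : CommRing (GrothendieckAddGroup S) where
  __ := (inferInstance : AddCommGroup (GrothendieckAddGroup S))
  mul x y := mulHom S x y
  one := of S 1
  mul_assoc := mulHom_assoc
  one_mul := mulHom_one
  mul_one x := (mulHom_comm x _).trans (mulHom_one x)
  left_distrib x y z := map_add (mulHom S x) y z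
  right_distrib x y z := DFunLike.congr_fun (map_add (mulHom S) x y) z
  zero_mul x := DFunLike.congr_fun (map_zero (mulHom S)) x
  mul_zero x := map_zero (mulHom S x)
  mul_comm := mulHom_comm

/-- The homomorphism of Grothendieck rings induced by a homomorphism of semirings. -/
noncomputable def map (f : S →+* T) : GrothendieckAddGroup S →+* GrothendieckAddGroup T where
  __ := GrothendieckAddGroup.lift ((of T).comp (f : S →+ T))
  map_one' := (lift_of _ _).trans (congrArg (of T) (map_one f))
  map_mul' x y := by
    let F : GrothendieckAddGroup S →+ GrothendieckAddGroup T :=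
      GrothendieckAddGroup.lift ((of T).comp (f : S →+ T))
    have hF (s : S) : F (of S s) = of T (f s) := lift_of _ s
    have h1 (s : S) : F.comp (mulHom S (of S s)) = (mulHom T (F (of S s))).comp F :=
      hom_ext fun t => by simp [mulHom_of, hF]
    have h : F.comp ((mulHom S).flip y) = ((mulHom T).flip (F y)).comp F :=
      hom_ext fun s => DFunLike.congr_fun (h1 s) y
    exact DFunLike.congr_fun h x

theorem map_of (f : S →+* T) (s : S) : map f (of S s) = of T (f s) :=
  lift_of _ s

end GrothendieckRing

/-- A finite `G`-set. -/
structure FinGSet (G : Type v) [Group G] : Type (v + 1) where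
  carrier : Type v
  [finite : Finite carrier]
  [action : MulAction G carrier]

namespace FinGSet

attribute [instance] FinGSet.finite FinGSet.action

variable {G : Type v} [Group G]

/-- Two finite `G`-sets are isomorphic if there is a `G`-equivariant bijection between them. -/
def Iso (X Y : FinGSet G) : Prop :=
  ∃ e : X.carrier ≃ Y.carrier, ∀ (g : G) (x : X.carrier), e (g • x) = g • e x

instance setoid (G : Type v) [Group G] : Setoid (FinGSet G) where
  r := Iso
  iseqv :=
    { refl := fun _ => ⟨Equiv.refl _, fun _ _ => rfl⟩
      symm := fun ⟨e, he⟩ => ⟨e.symm, fun g y => e.injective (by simp [he])⟩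
      trans := fun ⟨e, he⟩ ⟨f, hf⟩ => ⟨e.trans f, fun g x => by simp [he, hf]⟩ }

/-- Disjoint union. -/
def sum (X Y : FinGSet G) : FinGSet G := ⟨X.carrier ⊕ Y.carrier⟩

/-- Cartesian product, with the diagonal action. -/
def prod (X Y : FinGSet G) : FinGSet G := ⟨X.carrier × Y.carrier⟩

/-- The empty `G`-set. -/
def empty (G : Type v) [Group G] : FinGSet G :=
  letI : MulAction G PEmpty.{v + 1} :=
    { smul := fun _ x => x, one_smul := fun _ => rfl, mul_smul := fun _ _ _ => rfl }
  ⟨PEmpty.{v + 1}⟩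

/-- The one-point `G`-set. -/
def point (G : Type v) [Group G] : FinGSet G :=
  letI : MulAction G PUnit.{v + 1} :=
    { smul := fun _ x => x, one_smul := fun _ => rfl, mul_smul := fun _ _ _ => rfl }
  ⟨PUnit.{v + 1}⟩

/-- The `G`-set `G/H` of left cosets of `H`. -/
def coset (H : Subgroup G) [Finite (G ⧸ H)] : FinGSet G := ⟨G ⧸ H⟩

/-- Isomorphism classes of finite `G`-sets. -/
def IsoClass (G : Type v) [Group G] : Type (v + 1) := Quotient (FinGSet.setoid G)

/-- The isomorphism class of a finite `G`-set. -/
def toClass (X : FinGSet G) : IsoClass G := Quotient.mk _ X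

/-- Disjoint union of isomorphism classes. -/
instance (G : Type v) [Group G] : Add (IsoClass G) where
  add := Quotient.map₂ sum fun _ _ ⟨e, he⟩ _ _ ⟨f, hf⟩ => ⟨Equiv.sumCongr e f, by
    rintro g (x | y)
    · exact congrArg Sum.inl (he g x)
    · exact congrArg Sum.inr (hf g y)⟩

/-- Cartesian product of isomorphism classes. -/
instance (G : Type v) [Group G] : Mul (IsoClass G) where
  mul := Quotient.map₂ prod fun _ _ ⟨e, he⟩ _ _ ⟨f, hf⟩ => ⟨Equiv.prodCongr e f, by
    rintro g ⟨x, y⟩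
    exact Prod.ext (he g x) (hf g y)⟩

instance (G : Type v) [Group G] : Zero (IsoClass G) := ⟨toClass (empty G)⟩

instance (G : Type v) [Group G] : One (IsoClass G) := ⟨toClass (point G)⟩

/-- Isomorphism classes of finite `G`-sets form a commutative semiring under disjoint union and
cartesian product. -/
instance (G : Type v) [Group G] : CommSemiring (IsoClass G) where
  nsmul := nsmulRec
  add_assoc := by
    rintro ⟨X⟩ ⟨Y⟩ ⟨Z⟩
    refine Quotient.sound ⟨Equiv.sumAssoc _ _ _, ?_⟩
    rintro g ((x | y) | z) <;> rfl
  zero_add := by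
    rintro ⟨X⟩
    refine Quotient.sound ⟨Equiv.emptySum PEmpty _, ?_⟩
    rintro g (x | x)
    · exact x.elim
    · rfl
  add_zero := by
    rintro ⟨X⟩
    refine Quotient.sound ⟨Equiv.sumEmpty _ PEmpty, ?_⟩
    rintro g (x | x)
    · rfl
    · exact x.elim
  add_comm := by
    rintro ⟨X⟩ ⟨Y⟩
    refine Quotient.sound ⟨Equiv.sumComm _ _, ?_⟩
    rintro g (x | y) <;> rfl
  mul_assoc := by
    rintro ⟨X⟩ ⟨Y⟩ ⟨Z⟩
    exact Quotient.sound ⟨Equiv.prodAssoc _ _ _, fun _ _ => rfl⟩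
  one_mul := by
    rintro ⟨X⟩
    exact Quotient.sound ⟨Equiv.punitProd _, fun _ _ => rfl⟩
  mul_one := by
    rintro ⟨X⟩
    exact Quotient.sound ⟨Equiv.prodPUnit _, fun _ _ => rfl⟩
  mul_comm := by
    rintro ⟨X⟩ ⟨Y⟩
    exact Quotient.sound ⟨Equiv.prodComm _ _, fun _ _ => rfl⟩
  left_distrib := by
    rintro ⟨X⟩ ⟨Y⟩ ⟨Z⟩
    refine Quotient.sound ⟨Equiv.prodSumDistrib _ _ _, ?_⟩
    rintro g ⟨x, (y | z)⟩ <;> rfl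
  right_distrib := by
    rintro ⟨X⟩ ⟨Y⟩ ⟨Z⟩
    refine Quotient.sound ⟨Equiv.sumProdDistrib _ _ _, ?_⟩
    rintro g ⟨(x | y), z⟩ <;> rfl
  zero_mul := by
    rintro ⟨X⟩
    exact Quotient.sound ⟨Equiv.pemptyProd _, fun _ x => x.1.elim⟩
  mul_zero := by
    rintro ⟨X⟩
    exact Quotient.sound ⟨Equiv.prodPEmpty _, fun _ x => x.2.elim⟩

end FinGSet

/-- The Burnside ring `A(G)`: the Grothendieck ring of the semiring of isomorphism classes of
finite `G`-sets. -/
abbrev BurnsideRing (G : Type v) [Group G] : Type (v + 1) :=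
  Algebra.GrothendieckAddGroup (FinGSet.IsoClass G)

namespace QForm

open QuadraticMap

variable {k : Type u} [Field k]

theorem nondegenerate_of_equivalent {V W : Type*} [AddCommGroup V] [Module k V] [AddCommGroup W]
    [Module k W] [Invertible (2 : k)] {Q : QuadraticForm k V} {Q' : QuadraticForm k W}
    (h : Q.Equivalent Q') (hQ : Q.Nondegenerate) : Q'.Nondegenerate := by
  obtain ⟨e⟩ := h
  rw [nondegenerate_iff_radical_eq_bot] at hQ ⊢
  have := e.map_radical
  rw [hQ] at this
  simpa using this.symm

theorem equivalent_basisRepr {V : Type*} [AddCommGroup V] [Module k V]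
    [FiniteDimensional k V] (Q : QuadraticForm k V) :
    Q.Equivalent (Q.basisRepr (Module.finBasis k V)) :=
  ⟨Q.isometryEquivBasisRepr _⟩

theorem nondegenerate_iff {V : Type*} [AddCommGroup V] [Module k V] [Invertible (2 : k)]
    {Q : QuadraticForm k V} :
    Q.Nondegenerate ↔ ∀ x, (∀ y, associated Q x y = 0) → x = 0 := by
  rw [← nondegenerate_associated_iff, LinearMap.IsRefl.nondegenerate_iff_separatingLeft]
  · rfl
  · exact fun x y ↦ (congr_arg (· x y) (associated_flip k Q)).trans

theorem nondegenerate_prod {V W : Type*} [AddCommGroup V] [Module k V] [AddCommGroup W]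
    [Module k W] [Invertible (2 : k)] {Q : QuadraticForm k V} {Q' : QuadraticForm k W}
    (hQ : Q.Nondegenerate) (hQ' : Q'.Nondegenerate) : (Q.prod Q').Nondegenerate := by
  rw [nondegenerate_iff] at *
  rintro ⟨x, y⟩ h
  refine Prod.ext (hQ x fun z => ?_) (hQ' y fun z => ?_)
  · simpa using h (z, 0)
  · simpa using h (0, z)

theorem nondegenerate_tmul {V W : Type*} [AddCommGroup V] [Module k V] [AddCommGroup W]
    [Module k W] [FiniteDimensional k V] [FiniteDimensional k W]
    [Invertible (2 : k)] {Q : QuadraticForm k V} {Q' : QuadraticForm k W}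
    (hQ : Q.Nondegenerate) (hQ' : Q'.Nondegenerate) : (QuadraticForm.tmul Q Q').Nondegenerate := by
  rw [nondegenerate_iff] at *
  intro t ht
  have h1 : Function.Injective (TensorProduct.map (associated Q) (associated Q')) := by
    refine TensorProduct.map_injective_of_flat_flat _ _ ?_ ?_ <;>
    refine (injective_iff_map_eq_zero _).2 fun x hx => ?_
    · exact hQ x fun y => DFunLike.congr_fun hx y
    · exact hQ' x fun y => DFunLike.congr_fun hx y
  have h2 := (TensorProduct.dualDistribEquiv k V W).injective
  refine h1 (h2 ?_)
  rw [map_zero, map_zero]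
  have key : (TensorProduct.dualDistrib k V W) ∘ₗ
      (TensorProduct.map (associated Q) (associated Q')) = associated (QuadraticForm.tmul Q Q') := by
    ext a b c d
    simp [QuadraticForm.associated_tmul, mul_comm]
  ext c d
  exact (DFunLike.congr_fun (DFunLike.congr_fun key t) (c ⊗ₜ d)).trans (ht _)

/-- `(Q₁ ⊥ Q₂) ⊗ Q₃ ≅ (Q₁ ⊗ Q₃) ⊥ (Q₂ ⊗ Q₃)`. -/
theorem prod_tmul_equivalent {V₁ V₂ V₃ : Type*} [AddCommGroup V₁] [Module k V₁] [AddCommGroup V₂]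
    [Module k V₂] [AddCommGroup V₃] [Module k V₃] [Invertible (2 : k)]
    (Q₁ : QuadraticForm k V₁) (Q₂ : QuadraticForm k V₂) (Q₃ : QuadraticForm k V₃) :
    (QuadraticForm.tmul (Q₁.prod Q₂) Q₃).Equivalent ((QuadraticForm.tmul Q₁ Q₃).prod (QuadraticForm.tmul Q₂ Q₃)) := by
  have h : ((QuadraticForm.tmul Q₁ Q₃).prod (QuadraticForm.tmul Q₂ Q₃)).comp
      (TensorProduct.prodLeft k k V₁ V₂ V₃).toLinearMap = QuadraticForm.tmul (Q₁.prod Q₂) Q₃ := by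
    refine (QuadraticMap.associated_rightInverse k).injective ?_
    ext <;> simp [QuadraticForm.associated_tmul, QuadraticMap.associated_comp]
  exact ⟨{ TensorProduct.prodLeft k k V₁ V₂ V₃ with
    map_app' := fun x => DFunLike.congr_fun h x }⟩

/-- The tensor product of equivalent forms. -/
theorem equivalent_tmul {V₁ V₂ V₃ V₄ : Type*} [AddCommGroup V₁] [Module k V₁] [AddCommGroup V₂]
    [Module k V₂] [AddCommGroup V₃] [Module k V₃] [AddCommGroup V₄] [Module k V₄]
    [Invertible (2 : k)]
    {Q₁ : QuadraticForm k V₁} {Q₂ : QuadraticForm k V₂} {Q₃ : QuadraticForm k V₃}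
    {Q₄ : QuadraticForm k V₄} (h : Q₁.Equivalent Q₃) (h' : Q₂.Equivalent Q₄) :
    (QuadraticForm.tmul Q₁ Q₂).Equivalent (QuadraticForm.tmul Q₃ Q₄) := by
  obtain ⟨e⟩ := h
  obtain ⟨f⟩ := h'
  exact ⟨{ TensorProduct.congr e.toLinearEquiv f.toLinearEquiv with
    map_app' := fun x => (e.toIsometry.tmul f.toIsometry).map_app x }⟩

/-- A nondegenerate quadratic form over `k` in finitely many variables. -/
def Nondeg (k : Type u) [Field k] : Type u :=
  Σ n : ℕ, {Q : QuadraticForm k (Fin n → k) // Q.Nondegenerate}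

/-- Isometry of quadratic forms. -/
instance setoid (k : Type u) [Field k] : Setoid (Nondeg k) where
  r Q Q' := Q.2.1.Equivalent Q'.2.1
  iseqv := ⟨fun _ => .refl _, fun h => h.symm, fun h h' => h.trans h'⟩

/-- Isometry classes of nondegenerate quadratic forms over `k`. -/
def IsometryClass (k : Type u) [Field k] : Type u := Quotient (setoid k)

variable [Invertible (2 : k)]

/-- The isometry class of a nondegenerate quadratic form on a finite-dimensional vector space,
represented in coordinates. -/
noncomputable def toClass {V : Type*} [AddCommGroup V] [Module k V] [FiniteDimensional k V]
    (Q : QuadraticForm k V) (hQ : Q.Nondegenerate) : IsometryClass k :=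
  Quotient.mk _ ⟨_, Q.basisRepr (Module.finBasis k V),
    nondegenerate_of_equivalent (equivalent_basisRepr Q) hQ⟩

theorem toClass_eq_iff {V W : Type*} [AddCommGroup V] [Module k V] [FiniteDimensional k V]
    [AddCommGroup W] [Module k W] [FiniteDimensional k W]
    {Q : QuadraticForm k V} {hQ : Q.Nondegenerate} {Q' : QuadraticForm k W}
    {hQ' : Q'.Nondegenerate} : toClass Q hQ = toClass Q' hQ' ↔ Q.Equivalent Q' := by
  refine Quotient.eq.trans ⟨fun h => ?_, fun h => ?_⟩
  · exact (equivalent_basisRepr Q).trans (h.trans (equivalent_basisRepr Q').symm)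
  · exact (equivalent_basisRepr Q).symm.trans (h.trans (equivalent_basisRepr Q'))

theorem mk_eq_toClass (Q : Nondeg k) : Quotient.mk (setoid k) Q = toClass Q.2.1 Q.2.2 :=
  Quotient.sound (equivalent_basisRepr Q.2.1)

theorem exists_toClass (c : IsometryClass k) : ∃ (n : ℕ) (Q : QuadraticForm k (Fin n → k))
    (hQ : Q.Nondegenerate), c = toClass Q hQ := by
  obtain ⟨Q⟩ := c
  exact ⟨Q.1, Q.2.1, Q.2.2, mk_eq_toClass Q⟩

/-- Orthogonal sum. -/
noncomputable instance : Add (IsometryClass k) where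
  add := Quotient.lift₂ (fun Q Q' => toClass (Q.2.1.prod Q'.2.1) (nondegenerate_prod Q.2.2 Q'.2.2))
    fun _ _ _ _ h h' => toClass_eq_iff.2 (h.prod h')

/-- Tensor (Kronecker) product. -/
noncomputable instance : Mul (IsometryClass k) where
  mul := Quotient.lift₂ (fun Q Q' => toClass (QuadraticForm.tmul Q.2.1 Q'.2.1) (nondegenerate_tmul Q.2.2 Q'.2.2))
    fun _ _ _ _ h h' => toClass_eq_iff.2 (equivalent_tmul h h')

theorem nondegenerate_zero : (0 : QuadraticForm k PUnit.{1}).Nondegenerate :=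
  nondegenerate_iff.2 fun _ _ => rfl

theorem nondegenerate_sq : (QuadraticMap.sq : QuadraticForm k k).Nondegenerate :=
  nondegenerate_iff.2 fun x h => by simpa using h 1

/-- The form in zero variables. -/
noncomputable instance : Zero (IsometryClass k) :=
  ⟨toClass (0 : QuadraticForm k PUnit.{1}) nondegenerate_zero⟩

/-- The form `⟨1⟩`, that is `x ↦ x²`. -/
noncomputable instance : One (IsometryClass k) :=
  ⟨toClass (QuadraticMap.sq : QuadraticForm k k) nondegenerate_sq⟩

section

variable {V W : Type*} [AddCommGroup V] [Module k V] [FiniteDimensional k V]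
    [AddCommGroup W] [Module k W] [FiniteDimensional k W]
    {Q : QuadraticForm k V} (hQ : Q.Nondegenerate) {Q' : QuadraticForm k W}
    (hQ' : Q'.Nondegenerate)

theorem toClass_add : toClass Q hQ + toClass Q' hQ' = toClass (Q.prod Q') (nondegenerate_prod hQ hQ') :=
  (toClass_eq_iff (hQ := nondegenerate_prod
    (nondegenerate_of_equivalent (equivalent_basisRepr Q) hQ)
    (nondegenerate_of_equivalent (equivalent_basisRepr Q') hQ'))).2
    ((equivalent_basisRepr Q).prod (equivalent_basisRepr Q')).symm

theorem toClass_mul : toClass Q hQ * toClass Q' hQ' = toClass (QuadraticForm.tmul Q Q') (nondegenerate_tmul hQ hQ') :=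
  (toClass_eq_iff (hQ := nondegenerate_tmul
    (nondegenerate_of_equivalent (equivalent_basisRepr Q) hQ)
    (nondegenerate_of_equivalent (equivalent_basisRepr Q') hQ'))).2
    (equivalent_tmul (equivalent_basisRepr Q) (equivalent_basisRepr Q')).symm

end

theorem class_add_comm (a b : IsometryClass k) : a + b = b + a := by
  obtain ⟨_, _, hQ, rfl⟩ := exists_toClass a
  obtain ⟨_, _, hQ', rfl⟩ := exists_toClass b
  rw [toClass_add, toClass_add]
  exact toClass_eq_iff.2 ⟨.prodComm _ _⟩

theorem class_mul_comm (a b : IsometryClass k) : a * b = b * a := by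
  obtain ⟨_, _, hQ, rfl⟩ := exists_toClass a
  obtain ⟨_, _, hQ', rfl⟩ := exists_toClass b
  rw [toClass_mul, toClass_mul]
  exact toClass_eq_iff.2 ⟨QuadraticForm.tensorComm _ _⟩

theorem class_add_assoc (a b c : IsometryClass k) : a + b + c = a + (b + c) := by
  obtain ⟨_, _, hQ, rfl⟩ := exists_toClass a
  obtain ⟨_, _, hQ', rfl⟩ := exists_toClass b
  obtain ⟨_, _, hQ'', rfl⟩ := exists_toClass c
  simp only [toClass_add]
  exact toClass_eq_iff.2 ⟨{ LinearEquiv.prodAssoc k _ _ _ with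
    map_app' := fun x => (add_assoc _ _ _).symm }⟩

theorem class_mul_assoc (a b c : IsometryClass k) : a * b * c = a * (b * c) := by
  obtain ⟨_, _, hQ, rfl⟩ := exists_toClass a
  obtain ⟨_, _, hQ', rfl⟩ := exists_toClass b
  obtain ⟨_, _, hQ'', rfl⟩ := exists_toClass c
  simp only [toClass_mul]
  exact toClass_eq_iff.2 ⟨QuadraticForm.tensorAssoc _ _ _⟩

theorem class_zero_add (a : IsometryClass k) : 0 + a = a := by
  obtain ⟨_, _, hQ, rfl⟩ := exists_toClass a
  refine (toClass_add nondegenerate_zero hQ).trans (toClass_eq_iff.2 ?_)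
  exact ⟨{ LinearEquiv.uniqueProd (R := k) (M₂ := PUnit) with
    map_app' := fun x => by simp }⟩

theorem class_one_mul (a : IsometryClass k) : 1 * a = a := by
  obtain ⟨_, _, hQ, rfl⟩ := exists_toClass a
  exact (toClass_mul nondegenerate_sq hQ).trans
    (toClass_eq_iff.2 ⟨QuadraticForm.tensorLId _⟩)

theorem class_zero_mul (a : IsometryClass k) : 0 * a = 0 := by
  obtain ⟨_, _, hQ, rfl⟩ := exists_toClass a
  refine (toClass_mul nondegenerate_zero hQ).trans (toClass_eq_iff.2 ?_)
  exact ⟨{ (0 : PUnit ⊗[k] (Fin _ → k) ≃ₗ[k] PUnit) with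
    map_app' := fun x => by simp [Subsingleton.elim x 0] }⟩

theorem class_add_mul (a b c : IsometryClass k) : (a + b) * c = a * c + b * c := by
  obtain ⟨_, _, hQ, rfl⟩ := exists_toClass a
  obtain ⟨_, _, hQ', rfl⟩ := exists_toClass b
  obtain ⟨_, _, hQ'', rfl⟩ := exists_toClass c
  simp only [toClass_mul, toClass_add]
  exact toClass_eq_iff.2 (prod_tmul_equivalent _ _ _)

/-- Isometry classes of nondegenerate quadratic forms form a commutative semiring under
orthogonal sum and tensor product. -/
noncomputable instance : CommSemiring (IsometryClass k) where
  add_assoc := class_add_assoc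
  zero_add := class_zero_add
  add_zero a := (class_add_comm a 0).trans (class_zero_add a)
  add_comm := class_add_comm
  nsmul := nsmulRec
  mul_assoc := class_mul_assoc
  one_mul := class_one_mul
  mul_one a := (class_mul_comm a 1).trans (class_one_mul a)
  mul_comm := class_mul_comm
  zero_mul := class_zero_mul
  mul_zero a := (class_mul_comm a 0).trans (class_zero_mul a)
  right_distrib := class_add_mul
  left_distrib a b c := by
    rw [class_mul_comm a, class_add_mul, class_mul_comm b, class_mul_comm c]

end QForm

/-- The Grothendieck-Witt ring `GW(k)` of a field `k` of characteristic not `2`: the Grothendieck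
ring of the semiring of isometry classes of nondegenerate quadratic forms over `k`. The instance
`Invertible (2 : k)` says that the characteristic is not `2`. -/
abbrev GrothendieckWittRing (k : Type u) [Field k] [Invertible (2 : k)] : Type u :=
  Algebra.GrothendieckAddGroup (QForm.IsometryClass k)

/-- The trace form `x ↦ tr_{A/k}(x²)` of a `k`-algebra `A`. -/
noncomputable def traceQuadraticForm (k A : Type*) [Field k] [CommRing A] [Algebra k A] :
    QuadraticForm k A :=
  (Algebra.traceForm k A).toQuadraticMap

namespace Dress

open QForm QuadraticMap

theorem traceQuadraticForm_apply {k A : Type*} [Field k] [CommRing A] [Algebra k A] (x : A) :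
    traceQuadraticForm k A x = Algebra.trace k A (x * x) := rfl

theorem associated_traceQuadraticForm {k A : Type*} [Field k] [CommRing A] [Algebra k A]
    [Invertible (2 : k)] (x y : A) :
    associated (traceQuadraticForm k A) x y = Algebra.trace k A (x * y) := by
  have := associated_left_inverse k (B₁ := Algebra.traceForm k A)
    (fun x y => by rw [Algebra.traceForm_apply, Algebra.traceForm_apply, mul_comm])
  exact DFunLike.congr_fun (DFunLike.congr_fun this x) y

theorem traceQuadraticForm_equivalent {k A B : Type*} [Field k] [CommRing A] [Algebra k A]
    [CommRing B] [Algebra k B] (e : A ≃ₐ[k] B) :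
    (traceQuadraticForm k A).Equivalent (traceQuadraticForm k B) :=
  ⟨{ e.toLinearEquiv with
    map_app' := fun x => by
      change Algebra.trace k B (e x * e x) = Algebra.trace k A (x * x)
      rw [← map_mul, Algebra.trace_eq_of_algEquiv] }⟩

theorem traceQuadraticForm_nondegenerate {k E : Type*} [Field k] [Invertible (2 : k)] [Field E]
    [Algebra k E] [FiniteDimensional k E] [Algebra.IsSeparable k E] :
    (traceQuadraticForm k E).Nondegenerate :=
  nondegenerate_iff.2 fun x h => (traceForm_nondegenerate k E).1 x fun y => by
    rw [← h y, associated_traceQuadraticForm, Algebra.traceForm_apply]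

theorem comp_eq_tmul {k U V W : Type*} [Field k] [Invertible (2 : k)] [AddCommGroup U]
    [Module k U] [AddCommGroup V] [Module k V] [AddCommGroup W] [Module k W]
    (R : QuadraticForm k U) (Q : QuadraticForm k V) (Q' : QuadraticForm k W) (φ : V ⊗[k] W →ₗ[k] U)
    (h : ∀ v v' w w', associated R (φ (v ⊗ₜ w)) (φ (v' ⊗ₜ w')) =
      associated Q v v' * associated Q' w w') : R.comp φ = QuadraticForm.tmul Q Q' := by
  refine (QuadraticMap.associated_rightInverse k).injective ?_
  ext v w v' w'
  simp [QuadraticForm.associated_tmul, QuadraticMap.associated_comp, h, mul_comm]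

variable (k : Type u) (L : Type v) [Field k] [Field L] [Algebra k L]

/-- The `k`-algebra `Map_G(X, L)` of `G`-equivariant maps from a `G`-set `X` to `L`, where
`G = Gal(L/k)`. -/
def equivariantMaps (X : Type*) [MulAction (L ≃ₐ[k] L) X] : Subalgebra k (X → L) where
  carrier := {f | ∀ (g : L ≃ₐ[k] L) (x : X), f (g • x) = g (f x)}
  mul_mem' hf hf' g x := by simp [hf g x, hf' g x]
  add_mem' hf hf' g x := by simp [hf g x, hf' g x]
  algebraMap_mem' c g x := by simp

variable {k L}
variable {X : Type*} [MulAction (L ≃ₐ[k] L) X]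

theorem equivariantMaps_apply (f : equivariantMaps k L X) (g : L ≃ₐ[k] L) (x : X) :
    f.1 (g • x) = g (f.1 x) := f.2 g x

/-- The linear map `Map_G(X, L) ⊗ Map_G(Y, L) → Map_G(X × Y, L)`, `f ⊗ f' ↦ f(x) f'(y)`. -/
noncomputable def tensorMap (X Y : Type*) [MulAction (L ≃ₐ[k] L) X] [MulAction (L ≃ₐ[k] L) Y] :
    equivariantMaps k L X ⊗[k] equivariantMaps k L Y →ₗ[k] equivariantMaps k L (X × Y) :=
  TensorProduct.lift (LinearMap.mk₂ k
    (fun f f' => ⟨fun p => f.1 p.1 * f'.1 p.2, fun g p => by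
      simp only [Prod.smul_fst, Prod.smul_snd, equivariantMaps_apply, map_mul]⟩)
    (fun _ _ _ => Subtype.ext (funext fun _ => add_mul _ _ _))
    (fun _ _ _ => Subtype.ext (funext fun _ => smul_mul_assoc _ _ _))
    (fun _ _ _ => Subtype.ext (funext fun _ => mul_add _ _ _))
    (fun _ _ _ => Subtype.ext (funext fun _ => mul_smul_comm _ _ _)))

theorem tensorMap_tmul {X Y : Type*} [MulAction (L ≃ₐ[k] L) X] [MulAction (L ≃ₐ[k] L) Y]
    (f : equivariantMaps k L X) (f' : equivariantMaps k L Y) (p : X × Y) :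
    (tensorMap X Y (f ⊗ₜ f')).1 p = f.1 p.1 * f'.1 p.2 := rfl

variable [FiniteDimensional k L]

instance [Finite X] : FiniteDimensional k (equivariantMaps k L X) :=
  have := Fintype.ofFinite X
  inferInstanceAs (FiniteDimensional k (Subalgebra.toSubmodule (equivariantMaps k L X)))

/-- A linear functional on `X → L` that vanishes on all equivariant maps is zero. -/
theorem eq_zero_of_forall_sum [Fintype X] (c : X → L)
    (h : ∀ f : equivariantMaps k L X, ∑ x, c x * f.1 x = 0) : c = 0 := by
  classical
  funext x₀
  have hli := (linearIndependent_toLinearMap k L L).comp _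
    (AlgEquiv.coe_toAlgHom_injective (R := k) (A₁ := L) (A₂ := L))
  have key : ∑ g : L ≃ₐ[k] L, c (g • x₀) • ((g : L →ₐ[k] L).toLinearMap) = 0 := by
    refine LinearMap.ext fun a => ?_
    have := h ⟨fun y => ∑ g : L ≃ₐ[k] L, if g • x₀ = y then g a else 0, fun h y => by
      refine (Equiv.sum_comp (Equiv.mulLeft h)
        (fun g : L ≃ₐ[k] L => if g • x₀ = h • y then g a else 0)).symm.trans ?_
      rw [map_sum]
      refine Finset.sum_congr rfl fun g _ => ?_
      simp only [Equiv.coe_mulLeft, mul_smul, smul_left_cancel_iff]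
      split_ifs <;> simp⟩
    simp only [Finset.mul_sum] at this
    rw [Finset.sum_comm] at this
    simpa using this
  have := Fintype.linearIndependent_iff.1 hli (fun g => c (g • x₀)) key 1
  simpa using this

variable [IsGalois k L]

theorem exists_sum (X : Type*) [MulAction (L ≃ₐ[k] L) X] [Fintype X]
    (f : equivariantMaps k L X) : ∃ a : k, algebraMap k L a = ∑ x, f.1 x := by
  refine (IsGalois.mem_range_algebraMap_iff_fixed _).2 fun g => ?_
  rw [map_sum]
  simp only [← equivariantMaps_apply]
  exact Equiv.sum_comp (MulAction.toPerm g) f.1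

/-- The sum of the values of an equivariant map, as an element of `k`. -/
noncomputable def sumMap (X : Type*) [MulAction (L ≃ₐ[k] L) X] [Fintype X] :
    equivariantMaps k L X →ₗ[k] k where
  toFun f := (exists_sum X f).choose
  map_add' f f' := (algebraMap k L).injective (by
    rw [map_add, (exists_sum X _).choose_spec, (exists_sum X _).choose_spec,
      (exists_sum X _).choose_spec, ← Finset.sum_add_distrib]
    rfl)
  map_smul' a f := (algebraMap k L).injective (by
    rw [smul_eq_mul, map_mul, (exists_sum X _).choose_spec, RingHom.id_apply,
      (exists_sum X _).choose_spec, Finset.mul_sum]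
    exact Finset.sum_congr rfl fun x _ => Algebra.smul_def _ _)

theorem algebraMap_sumMap [Fintype X] (f : equivariantMaps k L X) :
    algebraMap k L (sumMap X f) = ∑ x, f.1 x := (exists_sum X f).choose_spec

/-- A basis of `Map_G(X, L)` over `k`, with dual basis. -/
theorem exists_dual_basis (X : Type*) [MulAction (L ≃ₐ[k] L) X] [Fintype X] [DecidableEq X] :
    ∃ (n : ℕ) (b : Module.Basis (Fin n) k (equivariantMaps k L X))
      (b' : Fin n → equivariantMaps k L X),
      (∀ f i, b.repr f i = sumMap X (f * b' i)) ∧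
      ∀ x y, ∑ i, (b i).1 x * (b' i).1 y = if x = y then 1 else 0 := by
  let B : LinearMap.BilinForm k (equivariantMaps k L X) :=
    (LinearMap.mul k (equivariantMaps k L X)).compr₂ (sumMap X)
  have hB (f f') : B f f' = sumMap X (f * f') := rfl
  have hs : B.IsSymm := ⟨fun f f' => by simp [hB, mul_comm]⟩
  have hnd : B.Nondegenerate := by
    rw [LinearMap.BilinForm.Nondegenerate, LinearMap.IsRefl.nondegenerate_iff_separatingLeft hs.isRefl]
    intro f hf
    refine Subtype.ext (eq_zero_of_forall_sum (k := k) f.1 fun f' => ?_)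
    have := congrArg (algebraMap k L) (hf f')
    rwa [hB, algebraMap_sumMap, map_zero] at this
  let b := Module.finBasis k (equivariantMaps k L X)
  let b' := B.dualBasis hnd b
  have h1 (f i) : b.repr f i = sumMap X (f * b' i) := by
    have : b.repr f i = B (b' i) f := by
      conv_rhs => rw [← b.sum_repr f]
      simp only [b', map_sum, map_smul, LinearMap.BilinForm.apply_dualBasis_left]
      simp
    rw [this, hB, mul_comm]
  refine ⟨_, b, b', h1, fun x y => ?_⟩
  have h2 : (fun z => ∑ i, (b i).1 x * (b' i).1 z - if x = z then 1 else 0) = 0 := by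
    refine eq_zero_of_forall_sum (k := k) _ fun f => ?_
    have h3 : f.1 x = ∑ i, algebraMap k L (b.repr f i) * (b i).1 x := by
      have := congrFun (congrArg Subtype.val (b.sum_repr f)) x
      rw [← this]
      simp [Algebra.smul_def]
    simp only [sub_mul, Finset.sum_sub_distrib, ite_mul, one_mul, zero_mul, Finset.sum_ite_eq,
      Finset.mem_univ, if_true, Finset.sum_mul]
    rw [h3, Finset.sum_comm, sub_eq_zero]
    refine Finset.sum_congr rfl fun i _ => ?_
    rw [h1, algebraMap_sumMap, Finset.sum_mul]
    refine Finset.sum_congr rfl fun z _ => ?_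
    simp
    ring
  exact sub_eq_zero.1 (congrFun h2 y)

/-- The trace of `Map_G(X, L)` over `k` is the sum of the values. -/
theorem trace_eq [Fintype X] (f : equivariantMaps k L X) :
    Algebra.trace k (equivariantMaps k L X) f = sumMap X f := by
  classical
  obtain ⟨n, b, b', h1, h2⟩ := exists_dual_basis (k := k) (L := L) X
  rw [Algebra.trace_eq_matrix_trace b, Matrix.trace]
  apply (algebraMap k L).injective
  simp only [Matrix.diag_apply, Algebra.leftMulMatrix_eq_repr_mul, map_sum, h1, algebraMap_sumMap]
  rw [Finset.sum_comm]
  refine Finset.sum_congr rfl fun x _ => ?_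
  have := h2 x x
  simp only [if_true] at this
  simp [mul_assoc, ← Finset.mul_sum, this]

theorem algebraMap_trace [Fintype X] (f : equivariantMaps k L X) :
    algebraMap k L (Algebra.trace k (equivariantMaps k L X) f) = ∑ x, f.1 x := by
  rw [trace_eq, algebraMap_sumMap]

theorem tensorMap_surjective (X Y : Type*) [MulAction (L ≃ₐ[k] L) X] [MulAction (L ≃ₐ[k] L) Y]
    [Fintype X] [Fintype Y] : Function.Surjective (tensorMap (k := k) (L := L) X Y) := by
  classical
  obtain ⟨n, b, b', -, hb⟩ := exists_dual_basis (k := k) (L := L) X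
  obtain ⟨m, c, c', -, hc⟩ := exists_dual_basis (k := k) (L := L) Y
  intro F
  refine ⟨∑ i, ∑ j, sumMap (X × Y) (F * tensorMap X Y (b' i ⊗ₜ c' j)) • (b i ⊗ₜ c j), ?_⟩
  refine Subtype.ext (funext fun p => ?_)
  simp only [map_sum, map_smul]
  have h1 : (∑ i, ∑ j, sumMap (X × Y) (F * tensorMap X Y (b' i ⊗ₜ c' j)) •
      tensorMap X Y (b i ⊗ₜ c j)).1 p =
      ∑ i, ∑ j, (∑ q : X × Y, F.1 q * ((b' i).1 q.1 * (c' j).1 q.2)) *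
        ((b i).1 p.1 * (c j).1 p.2) := by
    simp only [AddSubmonoidClass.coe_finsetSum, Finset.sum_apply]
    refine Finset.sum_congr rfl fun i _ => Finset.sum_congr rfl fun j _ => ?_
    rw [← tensorMap_tmul]
    refine (Algebra.smul_def _ _).trans ?_
    rw [algebraMap_sumMap]
    rfl
  rw [h1]
  calc _ = ∑ q : X × Y, F.1 q * ((∑ i, (b i).1 p.1 * (b' i).1 q.1) *
        ∑ j, (c j).1 p.2 * (c' j).1 q.2) := by
        simp only [Finset.sum_mul_sum]
        simp only [Finset.mul_sum]
        symm
        rw [Finset.sum_comm]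
        refine Finset.sum_congr rfl fun i _ => ?_
        rw [Finset.sum_comm]
        refine Finset.sum_congr rfl fun j _ => ?_
        rw [Finset.sum_mul]
        exact Finset.sum_congr rfl fun q _ => by ring
    _ = F.1 p := by
        simp only [hb, hc]
        rw [Finset.sum_eq_single p]
        · simp
        · rintro q - hq
          have : ¬ (p.1 = q.1 ∧ p.2 = q.2) := fun h => hq (Prod.ext h.1.symm h.2.symm)
          by_cases h1 : p.1 = q.1
          · have h2 : ¬ p.2 = q.2 := fun h => this ⟨h1, h⟩
            simp [h2]
          · simp [h1]
        · simp

variable [Invertible (2 : k)]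

theorem nondegenerate_equivariantMaps [Finite X] :
    (traceQuadraticForm k (equivariantMaps k L X)).Nondegenerate := by
  have := Fintype.ofFinite X
  refine nondegenerate_iff.2 fun f hf =>
    Subtype.ext (eq_zero_of_forall_sum (k := k) f.1 fun f' => ?_)
  have := congrArg (algebraMap k L) (hf f')
  rwa [associated_traceQuadraticForm, algebraMap_trace, map_zero] at this

/-- An isomorphism of `G`-sets induces an isomorphism of algebras of equivariant maps. -/
def congrEquiv {X Y : Type*} [MulAction (L ≃ₐ[k] L) X] [MulAction (L ≃ₐ[k] L) Y] (e : X ≃ Y)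
    (he : ∀ (g : L ≃ₐ[k] L) x, e (g • x) = g • e x) :
    equivariantMaps k L X ≃ₐ[k] equivariantMaps k L Y where
  toFun f := ⟨fun y => f.1 (e.symm y), fun g y => by
    obtain ⟨x, rfl⟩ := e.surjective y
    simp only [← he, e.symm_apply_apply, equivariantMaps_apply]⟩
  invFun f := ⟨fun x => f.1 (e x), fun g x => by simp only [he, equivariantMaps_apply]⟩
  left_inv f := Subtype.ext (funext fun x => by simp)
  right_inv f := Subtype.ext (funext fun x => by simp)
  map_mul' _ _ := rfl
  map_add' _ _ := rfl
  commutes' _ := rfl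

/-- `Map_G(G/H, L) = L^H`. -/
noncomputable def cosetEquiv (H : Subgroup (L ≃ₐ[k] L)) :
    equivariantMaps k L ((L ≃ₐ[k] L) ⧸ H) ≃ₐ[k] IntermediateField.fixedField H :=
  AlgEquiv.ofBijective
    (AlgHom.codRestrict ((Pi.evalAlgHom k (fun _ : (L ≃ₐ[k] L) ⧸ H => L) (1 : L ≃ₐ[k] L)).comp
      (equivariantMaps k L ((L ≃ₐ[k] L) ⧸ H)).val)
      (IntermediateField.fixedField H).toSubalgebra fun f => by
        refine (IntermediateField.mem_fixedField_iff H _).2 fun h hh => ?_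
        refine (equivariantMaps_apply f h _).symm.trans (congrArg f.1 ?_)
        exact QuotientGroup.eq.2 (by simpa using hh))
    (by
      constructor
      · intro f f' hff
        refine Subtype.ext (funext fun x => ?_)
        obtain ⟨g, rfl⟩ := QuotientGroup.mk_surjective x
        have h0 : f.1 ((1 : L ≃ₐ[k] L) : (L ≃ₐ[k] L) ⧸ H) = f'.1 ((1 : L ≃ₐ[k] L) : (L ≃ₐ[k] L) ⧸ H) :=
          congrArg Subtype.val hff
        have h1 : ((g : L ≃ₐ[k] L) : (L ≃ₐ[k] L) ⧸ H) = g • ((1 : L ≃ₐ[k] L) : (L ≃ₐ[k] L) ⧸ H) := by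
          rw [MulAction.Quotient.smul_coe, smul_eq_mul, mul_one]
        rw [h1, equivariantMaps_apply, equivariantMaps_apply, h0]
      · rintro ⟨a, ha⟩
        refine ⟨⟨Quotient.lift (fun g : L ≃ₐ[k] L => g a) fun g g' hgg => ?_, ?_⟩, ?_⟩
        · have := (IntermediateField.mem_fixedField_iff H a).1 ha _ (QuotientGroup.leftRel_apply.1 hgg)
          have := congrArg g this
          rw [AlgEquiv.mul_apply, ← AlgEquiv.mul_apply g, mul_inv_cancel] at this
          simpa using this.symm
        · intro g x
          obtain ⟨g', rfl⟩ := QuotientGroup.mk_surjective x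
          rfl
        · rfl)

/-- The class of the trace form of `Map_G(X, L)`. -/
noncomputable def classOf (X : Type*) [MulAction (L ≃ₐ[k] L) X] [Finite X] : IsometryClass k :=
  toClass (traceQuadraticForm k (equivariantMaps k L X)) nondegenerate_equivariantMaps

theorem classOf_congr {X Y : Type*} [MulAction (L ≃ₐ[k] L) X] [MulAction (L ≃ₐ[k] L) Y]
    [Finite X] [Finite Y] (e : X ≃ Y) (he : ∀ (g : L ≃ₐ[k] L) x, e (g • x) = g • e x) :
    classOf (k := k) (L := L) X = classOf (k := k) (L := L) Y :=
  toClass_eq_iff.2 (traceQuadraticForm_equivalent (congrEquiv e he))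

theorem classOf_empty {X : Type*} [MulAction (L ≃ₐ[k] L) X] [Finite X] [IsEmpty X] :
    classOf (k := k) (L := L) X = 0 := by
  have : Subsingleton (equivariantMaps k L X) := ⟨fun f f' => Subtype.ext (Subsingleton.elim _ _)⟩
  exact toClass_eq_iff.2 ⟨{ (0 : equivariantMaps k L X ≃ₗ[k] PUnit) with
    map_app' := fun x => by simp [Subsingleton.elim x 0] }⟩

theorem classOf_point {X : Type*} [MulAction (L ≃ₐ[k] L) X] [Finite X] [Unique X] :
    classOf (k := k) (L := L) X = 1 := by
  have := Fintype.ofFinite X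
  refine Eq.symm (toClass_eq_iff.2 ⟨{ LinearEquiv.ofBijective
    (Algebra.linearMap k (equivariantMaps k L X)) ⟨?_, fun f => ?_⟩ with
    map_app' := fun x => (algebraMap k L).injective ?_ }⟩)
  · exact fun a b h => (algebraMap k L).injective (congrFun (congrArg Subtype.val h) default)
  · refine ⟨sumMap X f, Subtype.ext (funext fun x => ?_)⟩
    change algebraMap k L (sumMap X f) = f.1 x
    rw [algebraMap_sumMap, Fintype.sum_unique, Subsingleton.elim x default]
  · change algebraMap k L (Algebra.trace k _ (algebraMap k (equivariantMaps k L X) x *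
      algebraMap k (equivariantMaps k L X) x)) = _
    rw [algebraMap_trace, Fintype.sum_unique, sq_apply, map_mul]
    rfl

theorem classOf_sum (X Y : FinGSet (L ≃ₐ[k] L)) :
    classOf (k := k) (L := L) (X.carrier ⊕ Y.carrier) =
      classOf (k := k) (L := L) X.carrier + classOf (k := k) (L := L) Y.carrier := by
  have := Fintype.ofFinite X.carrier
  have := Fintype.ofFinite Y.carrier
  refine Eq.trans (toClass_eq_iff.2 ⟨?_⟩) (toClass_add _ _).symm
  exact
    { toFun := fun f => (⟨fun x => f.1 (.inl x), fun g x => f.2 g (.inl x)⟩,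
        ⟨fun x => f.1 (.inr x), fun g x => f.2 g (.inr x)⟩)
      invFun := fun f => ⟨Sum.elim f.1.1 f.2.1, by
        rintro g (x | x)
        · exact f.1.2 g x
        · exact f.2.2 g x⟩
      map_add' := fun _ _ => rfl
      map_smul' := fun _ _ => rfl
      left_inv := fun f => Subtype.ext (funext (by rintro (x | x) <;> rfl))
      right_inv := fun f => rfl
      map_app' := fun f => (algebraMap k L).injective (by
        simp only [prod_apply, map_add, traceQuadraticForm_apply, algebraMap_trace]
        rw [Fintype.sum_sum_type]
        rfl) }

theorem associated_tensorMap {X Y : Type*} [MulAction (L ≃ₐ[k] L) X] [MulAction (L ≃ₐ[k] L) Y]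
    [Finite X] [Finite Y] :
    (traceQuadraticForm k (equivariantMaps k L (X × Y))).comp (tensorMap X Y) =
      QuadraticForm.tmul (traceQuadraticForm k (equivariantMaps k L X))
        (traceQuadraticForm k (equivariantMaps k L Y)) := by
  have := Fintype.ofFinite X
  have := Fintype.ofFinite Y
  refine comp_eq_tmul _ _ _ _ fun f₁ f₂ f₃ f₄ => (algebraMap k L).injective ?_
  simp only [associated_traceQuadraticForm, map_mul, algebraMap_trace, Finset.sum_mul_sum,
    ← Finset.univ_product_univ, Finset.sum_product]
  refine Finset.sum_congr rfl fun x _ => Finset.sum_congr rfl fun y _ => ?_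
  exact mul_mul_mul_comm _ _ _ _

theorem classOf_prod (X Y : Type*) [MulAction (L ≃ₐ[k] L) X] [MulAction (L ≃ₐ[k] L) Y]
    [Finite X] [Finite Y] :
    classOf (k := k) (L := L) (X × Y) =
      classOf (k := k) (L := L) X * classOf (k := k) (L := L) Y := by
  have := Fintype.ofFinite X
  have := Fintype.ofFinite Y
  refine Eq.trans (Eq.symm (toClass_eq_iff.2 ⟨?_⟩)) (toClass_mul _ _).symm
  have hq := associated_tensorMap (k := k) (L := L) (X := X) (Y := Y)
  have hinj : Function.Injective (tensorMap (k := k) (L := L) X Y) := by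
    refine (injective_iff_map_eq_zero _).2 fun t ht => ?_
    refine nondegenerate_iff.1 (nondegenerate_tmul (nondegenerate_equivariantMaps (k := k) (L := L)
      (X := X)) (nondegenerate_equivariantMaps (k := k) (L := L) (X := Y))) t fun s => ?_
    rw [← hq, QuadraticMap.associated_comp]
    simp [ht]
  exact { LinearEquiv.ofBijective (tensorMap X Y) ⟨hinj, tensorMap_surjective X Y⟩ with
    map_app' := fun t => DFunLike.congr_fun hq t }

variable (k L)

/-- The semiring homomorphism that sends a finite `G`-set `X` to the trace form of the étale
`k`-algebra `Map_G(X, L)`. -/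
noncomputable def classHom : FinGSet.IsoClass (L ≃ₐ[k] L) →+* IsometryClass k where
  toFun := Quotient.lift (fun X => classOf X.carrier) fun _ _ ⟨e, he⟩ => classOf_congr e he
  map_zero' :=
    have : IsEmpty (FinGSet.empty (L ≃ₐ[k] L)).carrier := inferInstanceAs (IsEmpty PEmpty)
    classOf_empty (X := (FinGSet.empty (L ≃ₐ[k] L)).carrier)
  map_one' :=
    have : Unique (FinGSet.point (L ≃ₐ[k] L)).carrier := inferInstanceAs (Unique PUnit)
    classOf_point (X := (FinGSet.point (L ≃ₐ[k] L)).carrier)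
  map_add' := by
    rintro ⟨X⟩ ⟨Y⟩
    exact classOf_sum X Y
  map_mul' := by
    rintro ⟨X⟩ ⟨Y⟩
    exact classOf_prod X.carrier Y.carrier

end Dress

/-- The Dress map `h_{L/k} : A(Gal(L/k)) → GW(k)`, the ring homomorphism that sends a finite
`G`-set `X` to the trace form of the étale `k`-algebra `Map_G(X, L)`; on a coset space `G/H` this
is the trace form of `L^H`, see `dressMap_coset`. -/
noncomputable def dressMap (k : Type u) (L : Type v) [Field k] [Field L] [Algebra k L]
    [FiniteDimensional k L] [IsGalois k L] [Invertible (2 : k)] :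
    BurnsideRing (L ≃ₐ[k] L) →+* GrothendieckWittRing k :=
  GrothendieckRing.map (Dress.classHom k L)

/-- The Dress map sends `G/H` to the trace form `x ↦ tr_{L^H/k}(x²)`. -/
theorem dressMap_coset (k : Type u) (L : Type v) [Field k] [Field L] [Algebra k L]
    [FiniteDimensional k L] [IsGalois k L] [Invertible (2 : k)] (H : Subgroup (L ≃ₐ[k] L)) :
    dressMap k L (GrothendieckRing.of _ (FinGSet.coset H).toClass) =
      GrothendieckRing.of _ (QForm.toClass
        (traceQuadraticForm k (IntermediateField.fixedField H))
        Dress.traceQuadraticForm_nondegenerate) :=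
  (GrothendieckRing.map_of _ _).trans (congrArg _ ((QForm.toClass_eq_iff (hQ := Dress.nondegenerate_equivariantMaps)).2
    (Dress.traceQuadraticForm_equivalent (Dress.cosetEquiv H))))

/-!
The image of a finite `G`-set under the Dress map is computed in the Grothendieck-Witt ring with
the classes `⟨a⟩`, which satisfy `⟨a⟩² = 1` and `⟨a⟩ + ⟨b⟩ = ⟨a + b⟩ (1 + ⟨ab⟩)`. A sign character
`ε` of `G`, with two-point set `S` and eigenvector `δ = √a` in `L`, has image `⟨2⟩ (1 + ⟨a⟩)`
(`Dress.classHom_signSet`).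

*Injectivity.* If `L = k(√a)`, every element of the Burnside ring is `m + n[S]`. An element of the
kernel has `m = -2n` by comparison of dimensions, and then `2n⟨a⟩ = 2n⟨1⟩`. By Witt cancellation the
two forms are isometric, so if `n ≠ 0` the form `2|n|⟨1⟩` represents `a`, and `a` is a sum of
squares (`Dress.injective_of_not_isSumSq`).

*Non-injectivity.* The Burnside ring is torsion-free, as fixed-point counts show, so it is enough to
find an element with a nonzero mark and torsion image.
* If an odd prime divides `|G|`, let `U` be a subgroup of that order and `V` a Sylow 2-subgroup.
  The element `x = |U| [G/U] - [G]` satisfies `[G/V] x = 0`, since `G/U × G/V` is free. The image of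
  `[G/V]` is a sum of an odd number of elements of square `1`; such a sum can annihilate only
  torsion elements, because its "eigenvalues" are odd integers
  (`GrothendieckRing.exists_nsmul_eq_zero`, `Dress.not_injective_of_coprime`).
* If `G` has two distinct nontrivial sign characters, then the biquadratic element
  `[S] + [S'] + [S''] - [S][S'] - 2` works (`Dress.not_injective_of_ne`).
* If `a` is a sum of squares, then `2 ^ m⟨a⟩ = 2 ^ m` for some `m`, and `2 - [S]` works
  (`Dress.not_injective_of_isSumSq`). This covers cyclic `2`-groups of order at least `4`, where
  `k(√a)` lies in a cyclic quartic extension and hence `a` is a sum of two squares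
  (`Dress.exists_isSumSq_of_cyclic`).

A finite `2`-group with only one nontrivial sign character is cyclic, so injectivity leaves only
`|G| = 2` with `a` not a sum of squares.
-/

/-! ### Diagonal forms -/

namespace QForm

open QuadraticMap

variable {k : Type u} [Field k] [Invertible (2 : k)]

theorem nondegenerate_smul_sq (a : kˣ) :
    ((a : k) • (QuadraticMap.sq : QuadraticForm k k)).Nondegenerate :=
  nondegenerate_iff.2 fun x h => by simpa using h 1

theorem toClass_eq_of_linearEquiv {V W : Type*} [AddCommGroup V] [Module k V]
    [FiniteDimensional k V] [AddCommGroup W] [Module k W] [FiniteDimensional k W]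
    {Q : QuadraticForm k V} {hQ : Q.Nondegenerate} {Q' : QuadraticForm k W}
    {hQ' : Q'.Nondegenerate} (e : V ≃ₗ[k] W) (he : ∀ x, Q' (e x) = Q x) :
    toClass Q hQ = toClass Q' hQ' :=
  toClass_eq_iff.2 ⟨{ e with map_app' := he }⟩

/-- The isometry class of the one-dimensional form `⟨a⟩`, that is `x ↦ a x²`, as a multiplicative
function of `a`. -/
noncomputable def rankOne (k : Type u) [Field k] [Invertible (2 : k)] : kˣ →* IsometryClass k where
  toFun a := toClass ((a : k) • (QuadraticMap.sq : QuadraticForm k k)) (nondegenerate_smul_sq a)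
  map_one' := toClass_eq_of_linearEquiv (LinearEquiv.refl k k) fun x => by simp
  map_mul' a b := by
    refine Eq.trans (Eq.symm ?_)
      (toClass_mul (nondegenerate_smul_sq a) (nondegenerate_smul_sq b)).symm
    have h := Dress.comp_eq_tmul (((a * b : kˣ) : k) • QuadraticMap.sq) ((a : k) • QuadraticMap.sq)
      ((b : k) • QuadraticMap.sq) (TensorProduct.lid k k).toLinearMap fun x x' y y' => by
        simp
        ring
    exact toClass_eq_of_linearEquiv (TensorProduct.lid k k) fun t => DFunLike.congr_fun h t

theorem rankOne_mul_sq (a b : kˣ) : rankOne k (a * b ^ 2) = rankOne k a :=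
  toClass_eq_of_linearEquiv (hQ := nondegenerate_smul_sq _) (hQ' := nondegenerate_smul_sq _)
    (LinearEquiv.smulOfUnit b) fun x => by
    change (a : k) * ((b * x) * (b * x)) = ((a * b ^ 2 : kˣ) : k) * (x * x)
    push_cast
    ring

theorem rankOne_mul_self (a : kˣ) : rankOne k a * rankOne k a = 1 := by
  rw [← map_mul, ← map_one (rankOne k), ← rankOne_mul_sq 1 a, ← pow_two, one_mul]

/-- The binary relation `⟨a⟩ ⊥ ⟨b⟩ ≅ ⟨a + b⟩ ⊥ ⟨ab(a + b)⟩`. -/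
theorem rankOne_add_rankOne (a b c : kˣ) (h : (a : k) + b = c) :
    rankOne k a + rankOne k b = rankOne k c * (1 + rankOne k (a * b)) := by
  rw [mul_add, mul_one, ← map_mul]
  refine (toClass_add (nondegenerate_smul_sq a) (nondegenerate_smul_sq b)).trans (Eq.trans
    (Eq.symm ?_) (toClass_add (nondegenerate_smul_sq c) (nondegenerate_smul_sq _)).symm)
  -- the orthogonal basis `(1, 1)`, `(b, -a)` of `⟨a⟩ ⊥ ⟨b⟩`
  let f : k × k →ₗ[k] k × k :=
    (LinearMap.fst k k k + (b : k) • LinearMap.snd k k k).prod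
      (LinearMap.fst k k k - (a : k) • LinearMap.snd k k k)
  have hf (x) : f x = (x.1 + b * x.2, x.1 - a * x.2) := rfl
  have hinj : Function.Injective f := by
    refine (injective_iff_map_eq_zero f).2 fun x hx => ?_
    rw [hf, Prod.mk_eq_zero] at hx
    have h2 : x.2 = 0 := by
      have : (c : k) * x.2 = 0 := by linear_combination hx.1 - hx.2 - x.2 * h
      simpa using this
    exact Prod.ext (by simpa [h2] using hx.1) h2
  refine toClass_eq_of_linearEquiv (LinearEquiv.ofInjectiveEndo f hinj) fun x => ?_
  simp [hf]
  rw [← h]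
  ring

theorem sum_rankOne {n : ℕ} (w : Fin n → kˣ) :
    ∃ hw : (weightedSumSquares k w).Nondegenerate,
      ∑ i, rankOne k (w i) = toClass (weightedSumSquares k w) hw := by
  induction n with
  | zero =>
    have hw : (weightedSumSquares k w).Nondegenerate :=
      nondegenerate_iff.2 fun x _ => Subsingleton.elim _ _
    exact ⟨hw, toClass_eq_of_linearEquiv (hQ := nondegenerate_zero)
      (0 : PUnit.{1} ≃ₗ[k] (Fin 0 → k)) fun x => by simp⟩
  | succ n ih =>
    obtain ⟨h, ih⟩ := ih fun i => w i.succ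
    have e : (((w 0 : k) • (QuadraticMap.sq : QuadraticForm k k)).prod
        (weightedSumSquares k fun i : Fin n => w i.succ)).Equivalent (weightedSumSquares k w) :=
      ⟨{ Fin.consLinearEquiv k (fun _ : Fin (n + 1) => k) with
        map_app' := fun x => by
          simp [weightedSumSquares_apply, Fin.sum_univ_succ, Units.smul_def] }⟩
    refine ⟨nondegenerate_of_equivalent e (nondegenerate_prod (nondegenerate_smul_sq _) h), ?_⟩
    rw [Fin.sum_univ_succ, ih]
    exact (toClass_add (nondegenerate_smul_sq _) h).trans (toClass_eq_iff.2 e)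

theorem toClass_eq_sum_rankOne {V : Type*} [AddCommGroup V] [Module k V] [FiniteDimensional k V]
    (Q : QuadraticForm k V) (hQ : Q.Nondegenerate) :
    ∃ w : Fin (Module.finrank k V) → kˣ, toClass Q hQ = ∑ i, rankOne k (w i) := by
  obtain ⟨w, hw⟩ := Q.equivalent_weightedSumSquares_units_of_nondegenerate'
    fun x hx => nondegenerate_iff.1 hQ x hx
  obtain ⟨h, hs⟩ := sum_rankOne w
  exact ⟨w, (toClass_eq_iff.2 hw).trans hs.symm⟩

theorem exists_eq_sum_rankOne (c : IsometryClass k) :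
    ∃ (n : ℕ) (w : Fin n → kˣ), c = ∑ i, rankOne k (w i) := by
  obtain ⟨n, Q, hQ, rfl⟩ := exists_toClass c
  exact ⟨_, toClass_eq_sum_rankOne Q hQ⟩

/-- The dimension of a form. -/
noncomputable def dim : IsometryClass k →+ ℕ where
  toFun := Quotient.lift Sigma.fst fun Q Q' ⟨e⟩ => by
    simpa using e.toLinearEquiv.finrank_eq
  map_zero' := Module.finrank_zero_of_subsingleton (R := k) (M := PUnit.{1})
  map_add' a b := by
    obtain ⟨_, _, hQ, rfl⟩ := exists_toClass a
    obtain ⟨_, _, hQ', rfl⟩ := exists_toClass b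
    rw [toClass_add]
    exact Module.finrank_prod

theorem dim_rankOne (a : kˣ) : dim (rankOne k a) = 1 := Module.finrank_self k

/-! ### Witt cancellation -/

/-- The reflection in the hyperplane orthogonal to `w`, an isometry when `Q w ≠ 0`. -/
theorem exists_reflection {K V : Type*} [Field K] [AddCommGroup V] [Module K V]
    (Q : QuadraticForm K V)
    {w : V} (hw : Q w ≠ 0) :
    ∃ e : Q.IsometryEquiv Q, ∀ x, e x = x - (polar Q x w / Q w) • w := by
  let f : V →ₗ[K] V := LinearMap.id - ((Q w)⁻¹ • (polarBilin Q).flip w).smulRight w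
  have hf (x) : f x = x - (polar Q x w / Q w) • w := by
    simp [f, div_eq_inv_mul]
  have hpw : polar Q w w = 2 * Q w := by simp
  have hff (x) : f (f x) = x := by
    have : polar Q (f x) w = - polar Q x w := by
      rw [hf, polar_sub_left, polar_smul_left, hpw, smul_eq_mul]
      field_simp
      ring
    rw [hf (f x), this, hf]
    module
  refine ⟨{ LinearEquiv.ofInvolutive f hff with map_app' := fun x => ?_ }, hf⟩
  change Q (f x) = Q x
  rw [hf, sub_eq_add_neg, ← neg_smul, QuadraticMap.map_add Q x, polar_smul_right,
    QuadraticMap.map_smul]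
  simp only [smul_eq_mul]
  field_simp
  ring

/-- The orthogonal group acts transitively on the vectors of a given nonzero length. -/
theorem exists_isometryEquiv_apply_eq {V : Type*} [AddCommGroup V] [Module k V]
    (Q : QuadraticForm k V) {x y : V} (h : Q x = Q y) (hx : Q x ≠ 0) :
    ∃ e : Q.IsometryEquiv Q, e x = y := by
  have hsub : Q (x - y) = 2 * Q x - polar Q x y := by
    rw [sub_eq_add_neg, QuadraticMap.map_add Q, QuadraticMap.map_neg, polar_neg_right, ← h]
    ring
  have hadd : Q (x + y) = 2 * Q x + polar Q x y := by
    rw [QuadraticMap.map_add Q, ← h]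
    ring
  have hxx : polar Q x x = 2 * Q x := by simp
  by_cases h0 : Q (x - y) = 0
  · have h1 : Q (x + y) ≠ 0 := by
      intro h1
      have h4 : (2 : k) * (2 * Q x) = 0 := by linear_combination h0 + h1 - hsub - hadd
      have h2 : (2 : k) ≠ 0 := Invertible.ne_zero 2
      simp [h2, hx] at h4
    obtain ⟨e, he⟩ := exists_reflection Q h1
    refine ⟨e.trans { LinearEquiv.neg k with map_app' := fun z => by simp }, ?_⟩
    change - e x = y
    rw [he, polar_add_right, hxx, ← hadd, div_self h1]
    module
  · obtain ⟨e, he⟩ := exists_reflection Q h0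
    refine ⟨e, ?_⟩
    rw [he, polar_sub_right, hxx, ← hsub, div_self h0]
    module

/-- Witt cancellation of a one-dimensional form. -/
theorem rankOne_add_cancel (a : kˣ) {c d : IsometryClass k}
    (h : rankOne k a + c = rankOne k a + d) : c = d := by
  obtain ⟨m, Q, hQ, rfl⟩ := exists_toClass c
  obtain ⟨n, Q', hQ', rfl⟩ := exists_toClass d
  have h' := ((toClass_add (nondegenerate_smul_sq a) hQ).symm.trans h).trans
    (toClass_add (nondegenerate_smul_sq a) hQ')
  obtain ⟨e⟩ := toClass_eq_iff.1 h'
  set S : QuadraticForm k k := (a : k) • QuadraticMap.sq with hS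
  have hS1 : (S.prod Q') (1, 0) = a := by simp [hS]
  have he1 : (S.prod Q') (e (1, 0)) = a := by simp [hS]
  obtain ⟨r, hr⟩ := exists_isometryEquiv_apply_eq (S.prod Q') (he1.trans hS1.symm)
    (by rw [he1]; exact a.ne_zero)
  have hpol (s : k) : polar S 1 s = 2 * a * s := by
    simp [polar, hS]
    ring
  let g := e.trans r
  have hg : g (1, 0) = (1, 0) := hr
  -- an isometry that fixes `(1, 0)` preserves the complement of `(1, 0)`
  have key {p q : ℕ} {P : QuadraticForm k (Fin p → k)} {P' : QuadraticForm k (Fin q → k)}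
      (g : (S.prod P).IsometryEquiv (S.prod P')) (hg : g (1, 0) = (1, 0)) (x : Fin p → k) :
      (g (0, x)).1 = 0 := by
    have h1 : polar (S.prod P') (g (1, 0)) (g (0, x)) = polar (S.prod P) (1, 0) (0, x) := by
      simp only [polar, ← map_add, g.map_app]
    have h2 : (2 : k) ≠ 0 := Invertible.ne_zero 2
    simpa [hg, hpol, h2] using h1
  have hgs : g.symm (1, 0) = (1, 0) := by
    rw [← hg]
    exact g.symm_apply_apply _
  refine toClass_eq_of_linearEquiv (LinearEquiv.ofLinearMap
    (LinearMap.snd k k _ ∘ₗ g.toLinearEquiv.toLinearMap ∘ₗ LinearMap.inr k k _)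
    (LinearMap.snd k k _ ∘ₗ g.symm.toLinearEquiv.toLinearMap ∘ₗ LinearMap.inr k k _) ?_ ?_)
    fun x => ?_
  · refine LinearMap.ext fun x => ?_
    have : ((0 : k), (g.symm (0, x)).2) = g.symm (0, x) := Prod.ext (key g.symm hgs x).symm rfl
    change (g (0, (g.symm (0, x)).2)).2 = x
    rw [this, g.apply_symm_apply]
  · refine LinearMap.ext fun x => ?_
    have : ((0 : k), (g (0, x)).2) = g (0, x) := Prod.ext (key g hg x).symm rfl
    change (g.symm (0, (g (0, x)).2)).2 = x
    rw [this, g.symm_apply_apply]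
  · have h1 := g.map_app (0, x)
    have h2 := key g hg x
    change Q' (g (0, x)).2 = Q x
    rw [prod_apply, prod_apply, h2] at h1
    simpa using h1

/-- Witt cancellation: the semiring of isometry classes is additively cancellative. -/
instance : IsCancelAdd (IsometryClass k) :=
  have (z c d : IsometryClass k) (h : z + c = z + d) : c = d := by
    obtain ⟨n, w, rfl⟩ := exists_eq_sum_rankOne z
    induction n with
    | zero => simpa using h
    | succ n ih =>
      rw [Fin.sum_univ_succ, add_assoc, add_assoc] at h
      exact ih _ (rankOne_add_cancel _ h)
  { add_left_cancel := fun z _ _ h => this z _ _ h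
    add_right_cancel := fun z c d h => this z c d (by rwa [add_comm z, add_comm z]) }

/-- If the forms `n⟨a⟩` and `n⟨1⟩` are isometric and `n > 0`, then `n⟨1⟩` represents `a`. -/
theorem isSumSq_of_nsmul_eq (a : kˣ) {n : ℕ} (hn : n ≠ 0)
    (h : n • rankOne k a = n • (1 : IsometryClass k)) : IsSumSq (a : k) := by
  obtain ⟨n, rfl⟩ := Nat.exists_eq_succ_of_ne_zero hn
  obtain ⟨h1, hs1⟩ := sum_rankOne fun _ : Fin (n + 1) => a
  obtain ⟨h2, hs2⟩ := sum_rankOne fun _ : Fin (n + 1) => (1 : kˣ)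
  rw [Finset.sum_const, Finset.card_univ, Fintype.card_fin] at hs1 hs2
  rw [map_one] at hs2
  obtain ⟨e⟩ := toClass_eq_iff.1 ((hs1.symm.trans h).trans hs2)
  have := e.map_app (Pi.single 0 1)
  have h3 : (weightedSumSquares k fun _ : Fin (n + 1) => a) (Pi.single 0 1) = (a : k) := by
    rw [weightedSumSquares_apply, Finset.sum_eq_single 0]
    · simp [Units.smul_def]
    · intro i _ hi
      simp [hi]
    · simp
  rw [h3, weightedSumSquares_apply] at this
  rw [← this]
  simp only [one_smul]
  exact IsSumSq.sum_mul_self _ _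

/-- If `a` is a sum of squares, then `2 ^ m⟨a⟩` and `2 ^ m⟨1⟩` are isometric for some `m`. -/
theorem exists_two_pow_mul_rankOne_eq {s : k} (hs : IsSumSq s) (a : kˣ) (ha : (a : k) = s) :
    ∃ m : ℕ, (2 : IsometryClass k) ^ m * rankOne k a = 2 ^ m := by
  induction hs generalizing a with
  | zero => exact absurd ha a.ne_zero
  | @sq_add x s hs ih =>
    by_cases hx : x = 0
    · exact ih a (by simpa [hx] using ha)
    have hx2 : rankOne k (Units.mk0 x hx ^ 2) = 1 := by
      rw [map_pow, pow_two, rankOne_mul_self]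
    by_cases h0 : s = 0
    · refine ⟨0, ?_⟩
      have : a = Units.mk0 x hx ^ 2 := Units.ext (by simpa [h0, pow_two] using ha)
      rw [this, hx2, mul_one]
    obtain ⟨m, hm⟩ := ih (Units.mk0 s h0) rfl
    have h := rankOne_add_rankOne (Units.mk0 x hx ^ 2) (Units.mk0 s h0) a (by simp [ha, pow_two])
    rw [map_mul, hx2, one_mul] at h
    refine ⟨m + 1, ?_⟩
    calc (2 : IsometryClass k) ^ (m + 1) * rankOne k a
        = rankOne k a * (2 ^ m + 2 ^ m) := by ring
      _ = 2 ^ m * (rankOne k a * (1 + rankOne k (Units.mk0 s h0))) := by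
        nth_rw 2 [← hm]
        ring
      _ = 2 ^ m + 2 ^ m * rankOne k (Units.mk0 s h0) := by
        rw [← h]
        ring
      _ = 2 ^ (m + 1) := by
        rw [hm]
        ring

/-- `⟨2⟩ ⊥ ⟨2⟩ ≅ ⟨1⟩ ⊥ ⟨1⟩`. -/
theorem two_mul_rankOne_two : 2 * rankOne k (unitOfInvertible 2) = 2 := by
  have h := rankOne_add_rankOne (1 : kˣ) 1 (unitOfInvertible 2) (by simp; norm_num)
  rw [one_mul, map_one] at h
  rw [one_add_one_eq_two, mul_comm] at h
  exact h.symm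

end QForm

/-! ### Grothendieck rings -/

namespace GrothendieckRing

open Algebra

/-- The canonical homomorphism from a commutative semiring to its Grothendieck ring. -/
noncomputable def ofHom (S : Type*) [CommSemiring S] : S →+* GrothendieckAddGroup S where
  __ := of S
  map_one' := rfl
  map_mul' s t := (mulHom_of s t).symm

theorem exists_eq_of_sub_of {M : Type*} [AddCommMonoid M] (x : GrothendieckAddGroup M) :
    ∃ s t : M, x = of M s - of M t := by
  induction x using AddLocalization.induction_on with
  | H y =>
    refine ⟨y.1, y.2, ?_⟩
    change AddLocalization.mk y.1 y.2 = AddLocalization.mk y.1 0 - AddLocalization.mk y.2.1 0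
    rw [GrothendieckAddGroup.mk_sub_mk]
    simp

/-- The canonical homomorphism from a cancellative semiring to its Grothendieck ring is
injective. -/
theorem of_injective {M : Type*} [AddCommMonoid M] [IsCancelAdd M] :
    Function.Injective (of M) :=
  GrothendieckAddGroup.of_injective

/-- A sum `t` of `n` elements of square `1` has only integers of the same parity as `n` as
eigenvalues, up to torsion: if `t c = d c` with `n + d` odd, then `c` is torsion. -/
theorem exists_nsmul_eq_zero {R : Type*} [CommRing R] {n : ℕ} (w : Fin n → R)
    (hw : ∀ i, w i * w i = 1) (d : ℤ) (hd : Odd (n + d)) (c : R) (hc : (∑ i, w i) * c = d * c) :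
    ∃ N : ℕ, N ≠ 0 ∧ N * c = 0 := by
  induction n generalizing d c with
  | zero =>
    have hd0 : d ≠ 0 := by
      rintro rfl
      simp at hd
    refine ⟨d.natAbs, Int.natAbs_ne_zero.2 hd0, ?_⟩
    have h0 : (d : R) * c = 0 := by simpa using hc.symm
    obtain h | h := Int.natAbs_eq d
    · rw [h] at h0
      simpa using h0
    · rw [h] at h0
      simpa using h0
  | succ n ih =>
    rw [Fin.sum_univ_succ] at hc
    have hu := hw 0
    -- the components of `c` on which `w 0` acts as `1` and as `-1`
    obtain ⟨N₁, hN₁, h₁⟩ := ih (fun i => w i.succ) (fun i => hw _) (d - 1)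
      (by convert! hd.sub_even even_two using 1; push_cast; ring) ((w 0 + 1) * c) (by
        push_cast
        linear_combination (w 0 + 1) * hc - c * hu)
    obtain ⟨N₂, hN₂, h₂⟩ := ih (fun i => w i.succ) (fun i => hw _) (d + 1)
      (by convert! hd using 1; push_cast; ring) ((w 0 - 1) * c) (by
        push_cast
        linear_combination (w 0 - 1) * hc - c * hu)
    refine ⟨2 * (N₁ * N₂), by positivity, ?_⟩
    push_cast
    linear_combination N₂ * h₁ - N₁ * h₂

end GrothendieckRing

/-! ### Finite `G`-sets -/

namespace FinGSet

variable {G : Type v} [Group G]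

theorem toClass_eq_of_equiv {X Y : FinGSet G} (e : X.carrier ≃ Y.carrier)
    (he : ∀ (g : G) x, e (g • x) = g • e x) : X.toClass = Y.toClass :=
  Quotient.sound ⟨e, he⟩

/-- The mark of a subgroup `U`: the number of points of a `G`-set that are fixed by `U`. -/
noncomputable def mark (U : Subgroup G) : IsoClass G →+ ℕ where
  toFun := Quotient.lift (fun X => Nat.card {x : X.carrier // ∀ g ∈ U, g • x = x})
    fun _ _ ⟨e, he⟩ => Nat.card_congr (e.subtypeEquiv fun x => by
      simp only [← he, e.apply_eq_iff_eq])
  map_zero' := by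
    have : IsEmpty (FinGSet.empty G).carrier := inferInstanceAs (IsEmpty PEmpty)
    exact Nat.card_of_isEmpty (α := {x : (FinGSet.empty G).carrier // ∀ g ∈ U, g • x = x})
  map_add' := by
    rintro ⟨X⟩ ⟨Y⟩
    refine Eq.trans (Nat.card_congr ?_) Nat.card_sum
    refine (Equiv.subtypeSum (p := fun x : X.carrier ⊕ Y.carrier => ∀ g ∈ U, g • x = x)).trans
      (Equiv.sumCongr ?_ ?_)
    · exact Equiv.subtypeEquivRight fun x => forall₂_congr fun g _ => Sum.inl_injective.eq_iff
    · exact Equiv.subtypeEquivRight fun x => forall₂_congr fun g _ => Sum.inr_injective.eq_iff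

theorem mark_toClass (U : Subgroup G) (X : FinGSet G) :
    mark U X.toClass = Nat.card {x : X.carrier // ∀ g ∈ U, g • x = x} := rfl

theorem mark_bot (X : FinGSet G) : mark ⊥ X.toClass = Nat.card X.carrier := by
  rw [mark_toClass]
  exact Nat.card_congr (Equiv.subtypeUnivEquiv fun x g hg => by
    rw [Subgroup.mem_bot.1 hg, one_smul])

theorem mark_one (U : Subgroup G) : mark U 1 = 1 := by
  have : Unique (point G).carrier := inferInstanceAs (Unique PUnit)
  refine (mark_toClass U (point G)).trans ?_
  rw [Nat.card_eq_one_iff_unique]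
  exact ⟨inferInstance, ⟨default, fun g _ => Subsingleton.elim _ _⟩⟩

theorem mark_eq_zero {U : Subgroup G} {X : FinGSet G}
    (h : ∀ x : X.carrier, ∃ g ∈ U, g • x ≠ x) : mark U X.toClass = 0 := by
  have : IsEmpty {x : X.carrier // ∀ g ∈ U, g • x = x} := ⟨fun x =>
    have ⟨g, hg, hx⟩ := h x.1
    hx (x.2 g hg)⟩
  exact Nat.card_of_isEmpty

/-- The `G`-subset cut out by an invariant predicate. -/
def subset (X : FinGSet G) (p : X.carrier → Prop) (hp : ∀ (g : G) x, p x → p (g • x)) :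
    FinGSet G :=
  letI : MulAction G {x : X.carrier // p x} :=
    { smul := fun g x => ⟨g • x.1, hp g x.1 x.2⟩
      one_smul := fun _ => Subtype.ext (one_smul _ _)
      mul_smul := fun _ _ _ => Subtype.ext (mul_smul _ _ _) }
  ⟨{x : X.carrier // p x}⟩

theorem toClass_subset_add (X : FinGSet G) (p : X.carrier → Prop)
    (hp : ∀ (g : G) x, p x → p (g • x)) (hp' : ∀ (g : G) x, ¬ p x → ¬ p (g • x)) :
    (X.subset p hp).toClass + (X.subset _ hp').toClass = X.toClass := by
  classical
  refine toClass_eq_of_equiv (X := (X.subset p hp).sum (X.subset _ hp'))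
    (Equiv.sumCompl p) ?_
  rintro g (x | x) <;> rfl

theorem smul_mem_orbit_iff {α : Type*} [MulAction G α] (g : G) (y x : α) :
    g • y ∈ MulAction.orbit G x ↔ y ∈ MulAction.orbit G x := by
  rw [← MulAction.orbit_eq_iff, MulAction.orbit_smul, MulAction.orbit_eq_iff]

theorem toClass_coset_stabilizer [Finite G] (X : FinGSet G) (x : X.carrier) :
    (coset (MulAction.stabilizer G x)).toClass =
      (X.subset (· ∈ MulAction.orbit G x)
        fun g _ h => (smul_mem_orbit_iff g _ x).2 h).toClass :=
  toClass_eq_of_equiv (MulAction.orbitEquivQuotientStabilizer G x).symm fun g y => by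
    obtain ⟨h, rfl⟩ := QuotientGroup.mk_surjective y
    exact Subtype.ext (mul_smul g h x)

/-- The class of a finite `G`-set lies in the additive submonoid spanned by the classes of its
orbits `G/G_x`. -/
theorem toClass_mem [Finite G] (A : AddSubmonoid (IsoClass G)) (X : FinGSet G)
    (h : ∀ x : X.carrier, (coset (MulAction.stabilizer G x)).toClass ∈ A) : X.toClass ∈ A := by
  induction hn : Nat.card X.carrier using Nat.strong_induction_on generalizing X with
  | _ n ih =>
    subst hn
    obtain hX | ⟨⟨x⟩⟩ := isEmpty_or_nonempty X.carrier
    · have : X.toClass = 0 := toClass_eq_of_equiv (Y := empty G) (Equiv.equivPEmpty _)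
        fun g x => isEmptyElim x
      rw [this]
      exact zero_mem A
    have hp (g : G) (y : X.carrier) : y ∉ MulAction.orbit G x → g • y ∉ MulAction.orbit G x :=
      fun hy hgy => hy ((smul_mem_orbit_iff g _ x).1 hgy)
    rw [← toClass_subset_add X (· ∈ MulAction.orbit G x)
      (fun g _ h => (smul_mem_orbit_iff g _ x).2 h) hp, ← toClass_coset_stabilizer]
    refine add_mem (h x) (ih _ ?_ _ (fun y => ?_) rfl)
    · exact Finite.card_subtype_lt (x := x) fun hx => hx (MulAction.mem_orbit_self x)
    · have : MulAction.stabilizer G y = MulAction.stabilizer G y.1 :=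
        Subgroup.ext fun g => Subtype.ext_iff
      convert! h y.1

/-- A finite `G`-set with free action is a multiple of the regular `G`-set. -/
theorem exists_toClass_eq_nsmul [Finite G] (X : FinGSet G)
    (h : ∀ (g : G) (x : X.carrier), g • x = x → g = 1) :
    ∃ m : ℕ, m * Nat.card G = Nat.card X.carrier ∧
      X.toClass = m * (coset (⊥ : Subgroup G)).toClass := by
  have := toClass_mem (AddSubmonoid.multiples (coset (⊥ : Subgroup G)).toClass) X fun x => by
    have : MulAction.stabilizer G x = ⊥ := (Subgroup.eq_bot_iff_forall _).2 fun g hg => h g x hg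
    convert! AddSubmonoid.mem_multiples _
  obtain ⟨m, hm⟩ := AddSubmonoid.mem_multiples_iff _ _ |>.1 this
  refine ⟨m, ?_, by rw [← hm, nsmul_eq_mul]⟩
  rw [← mark_bot, ← hm, map_nsmul, mark_bot, smul_eq_mul]
  exact congrArg _ (Nat.card_congr (QuotientGroup.quotientBot (G := G)).toEquiv.symm)

theorem toClass_coset_top [Finite G] : (coset (⊤ : Subgroup G)).toClass = 1 :=
  toClass_eq_of_equiv (Y := point G)
    { toFun := fun _ => PUnit.unit
      invFun := fun _ => ((1 : G) : G ⧸ (⊤ : Subgroup G))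
      left_inv := fun x => by
        obtain ⟨g, rfl⟩ := QuotientGroup.mk_surjective x
        exact QuotientGroup.eq.2 (Subgroup.mem_top _)
      right_inv := fun _ => rfl } fun _ _ => rfl

/-- If the orders of `U` and `V` are coprime, then `|U| [G/U] [G/V] = [G] [G/V]`. -/
theorem card_mul_toClass_coset_mul [Finite G] (U V : Subgroup G)
    (h : (Nat.card U).Coprime (Nat.card V)) :
    Nat.card U * (coset U).toClass * (coset V).toClass =
      (coset (⊥ : Subgroup G)).toClass * (coset V).toClass := by
  have hf (W : Subgroup G) (hW : (Nat.card W).Coprime (Nat.card V)) (g : G)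
      (x : ((coset W).prod (coset V)).carrier) (hx : g • x = x) : g = 1 := by
    obtain ⟨x, y⟩ := x
    have hord (W : Subgroup G) (z : G ⧸ W) (hz : g • z = z) : orderOf g ∣ Nat.card W := by
      obtain ⟨a, rfl⟩ := QuotientGroup.mk_surjective z
      have hmem : a⁻¹ * (g * a) ∈ W := QuotientGroup.eq.1 hz.symm
      have := Subgroup.orderOf_dvd_natCard W hmem
      rwa [← mul_assoc, ← MulAut.conj_inv_apply, MulEquiv.orderOf_eq] at this
    exact orderOf_eq_one_iff.1 (Nat.eq_one_of_dvd_coprimes hW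
      (hord W x (congrArg Prod.fst hx)) (hord V y (congrArg Prod.snd hx)))
  obtain ⟨m, hm, hm'⟩ := exists_toClass_eq_nsmul _ (hf U h)
  obtain ⟨n, hn, hn'⟩ := exists_toClass_eq_nsmul _ (hf ⊥ (by simp))
  change (coset U).toClass * (coset V).toClass = _ at hm'
  change (coset (⊥ : Subgroup G)).toClass * (coset V).toClass = _ at hn'
  rw [mul_assoc, hm', hn', ← mul_assoc, ← Nat.cast_mul]
  congr 2
  have hcard (W : Subgroup G) : Nat.card ((coset W).prod (coset V)).carrier =
      Nat.card (G ⧸ W) * Nat.card (G ⧸ V) := Nat.card_prod _ _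
  rw [hcard] at hm hn
  refine Nat.eq_of_mul_eq_mul_right (Nat.card_pos (α := G)) ?_
  rw [hn, mul_assoc, hm, ← mul_assoc, mul_comm (Nat.card U),
    ← Subgroup.card_eq_card_quotient_mul_card_subgroup]
  congr 1
  exact Nat.card_congr (QuotientGroup.quotientBot (G := G)).toEquiv.symm

theorem mark_coset_self_ne_zero [Finite G] (U : Subgroup G) : mark U (coset U).toClass ≠ 0 := by
  rw [mark_toClass, Nat.card_ne_zero]
  refine ⟨⟨((1 : G) : G ⧸ U), fun g hg => QuotientGroup.eq.2 ?_⟩, inferInstance⟩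
  simpa using hg

theorem mark_coset_bot [Finite G] {U : Subgroup G} (hU : U ≠ ⊥) :
    mark U (coset (⊥ : Subgroup G)).toClass = 0 := by
  refine mark_eq_zero fun x => ?_
  obtain ⟨a, rfl⟩ := QuotientGroup.mk_surjective x
  obtain ⟨⟨g, hg⟩, hg1⟩ := Subgroup.ne_bot_iff_exists_ne_one.1 hU
  refine ⟨g, hg, fun h => hg1 (Subtype.ext ?_)⟩
  have := QuotientGroup.eq.1 (h : ((g * a : G) : G ⧸ (⊥ : Subgroup G)) = a)
  rw [Subgroup.mem_bot] at this
  simpa using inv_mul_eq_one.1 this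

/-! ### Two-point sets -/

/-- The two-point `G`-set on which `G` acts through a sign character `ε`. -/
def signSet (ε : G →* ℤˣ) : FinGSet G :=
  letI : MulAction G (ULift.{v} ℤˣ) :=
    { smul := fun g x => ⟨ε g * x.down⟩
      one_smul := fun x => ULift.ext _ _ (by simp [HSMul.hSMul])
      mul_smul := fun g h x => ULift.ext _ _ (by simp [HSMul.hSMul, mul_assoc]) }
  ⟨ULift.{v} ℤˣ⟩

namespace signSet

variable {ε : G →* ℤˣ}

instance : Fintype (signSet ε).carrier := inferInstanceAs (Fintype (ULift ℤˣ))

/-- A point of the two-point `G`-set, as a sign. -/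
def val (x : (signSet ε).carrier) : ℤˣ := ULift.down x

/-- A sign, as a point of the two-point `G`-set. -/
def mk (ε : G →* ℤˣ) (u : ℤˣ) : (signSet ε).carrier := ULift.up u

@[simp]
theorem val_mk (u : ℤˣ) : val (mk ε u) = u := rfl

theorem eq_one_or_neg_one (x : (signSet ε).carrier) : x = mk ε 1 ∨ x = mk ε (-1) :=
  (Int.units_eq_one_or x.down).imp (ULift.ext x _) (ULift.ext x _)

theorem sum_eq {M : Type*} [AddCommMonoid M] (f : (signSet ε).carrier → M) :
    ∑ x, f x = f (mk ε 1) + f (mk ε (-1)) :=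
  (Equiv.sum_comp (Equiv.ulift (α := ℤˣ)).symm f).symm.trans (by
    rw [UnitsInt.univ, Finset.sum_pair (by decide)]
    rfl)

theorem val_smul (g : G) (x : (signSet ε).carrier) : val (g • x) = ε g * val x := rfl

theorem smul_mk (g : G) (u : ℤˣ) : g • mk ε u = mk ε (ε g * u) := rfl

theorem smul_ne {g : G} (hg : ε g ≠ 1) (x : (signSet ε).carrier) :
    g • x ≠ x := fun h => hg (by
  have := congrArg val h
  rwa [val_smul, mul_eq_right] at this)

end signSet

theorem toClass_coset_bot_eq_signSet [Finite G] {ε : G →* ℤˣ} (hε : Function.Bijective ε) :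
    (coset (⊥ : Subgroup G)).toClass = (signSet ε).toClass :=
  Eq.symm <| toClass_eq_of_equiv (X := signSet ε)
    (Equiv.ulift.trans ((Equiv.ofBijective ε hε).symm.trans
      (QuotientGroup.quotientBot (G := G)).toEquiv.symm)) fun g x => by
      obtain ⟨h, hh⟩ := hε.2 (signSet.val x)
      have hx (y : (signSet ε).carrier) (h : G) (hy : ε h = signSet.val y) :
          (Equiv.ofBijective ε hε).symm (signSet.val y) = h := by
        rw [← hy]
        exact Equiv.ofBijective_symm_apply_apply ε hε h
      change QuotientGroup.mk _ = g • QuotientGroup.mk _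
      change QuotientGroup.mk ((Equiv.ofBijective ε hε).symm (signSet.val (g • x))) =
        g • QuotientGroup.mk ((Equiv.ofBijective ε hε).symm (signSet.val x))
      rw [hx x h hh, hx (g • x) (g * h) (by rw [map_mul, hh, signSet.val_smul])]
      rfl

end FinGSet

/-! ### Trace forms of quadratic extensions -/

namespace Dress

open QForm QuadraticMap FinGSet

theorem two_ne_zero_of_algebra (k L : Type*) [Field k] [Field L] [Algebra k L]
    [Invertible (2 : k)] : (2 : L) ≠ 0 := by
  rw [← map_ofNat (algebraMap k L) 2]
  exact (map_ne_zero _).2 (Invertible.ne_zero 2)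

section

variable {k : Type u} {L : Type v} [Field k] [Field L] [Algebra k L] [FiniteDimensional k L]

/-- Every sign character of the Galois group has an eigenvector in `L`. -/
theorem exists_signEigenvector (ε : (L ≃ₐ[k] L) →* ℤˣ) :
    ∃ δ : L, δ ≠ 0 ∧ ∀ σ : L ≃ₐ[k] L, σ δ = ((ε σ : ℤ) : L) * δ := by
  have hli := (linearIndependent_toLinearMap k L L).comp _
    (AlgEquiv.coe_toAlgHom_injective (R := k) (A₁ := L) (A₂ := L))
  -- by independence of automorphisms, the `ε`-twisted trace does not vanish
  have hz : ∃ z : L, ∑ σ : L ≃ₐ[k] L, ((ε σ : ℤ) : L) * σ z ≠ 0 := by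
    by_contra! h
    have h1 := Fintype.linearIndependent_iff.1 hli (fun σ => ((ε σ : ℤ) : L))
      (LinearMap.ext fun z => by simpa using h z) 1
    simp at h1
  obtain ⟨z, hz⟩ := hz
  refine ⟨_, hz, fun τ => ?_⟩
  rw [map_sum, Finset.mul_sum]
  refine Eq.trans (Finset.sum_congr rfl fun σ _ => ?_) (Equiv.sum_comp (Equiv.mulLeft τ) _)
  have hτ : ((ε τ : ℤ) : L) * ((ε τ : ℤ) : L) = 1 := by
    rw [← Int.cast_mul, ← Units.val_mul, Int.units_mul_self, Units.val_one, Int.cast_one]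
  rw [Equiv.coe_mulLeft, map_mul ε, map_mul, map_intCast, Units.val_mul, Int.cast_mul,
    AlgEquiv.mul_apply]
  linear_combination (-((ε σ : ℤ) : L) * τ (σ z)) * hτ

variable [IsGalois k L] {ε : (L ≃ₐ[k] L) →* ℤˣ} {δ : L}

theorem exists_algebraMap_eq_sq (h0 : δ ≠ 0) (hδ : ∀ σ : L ≃ₐ[k] L, σ δ = ((ε σ : ℤ) : L) * δ) :
    ∃ a : kˣ, algebraMap k L a = δ ^ 2 := by
  obtain ⟨a, ha⟩ := (IsGalois.mem_range_algebraMap_iff_fixed (δ ^ 2)).2 fun σ => by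
    rw [map_pow, hδ, mul_pow, ← Int.cast_pow, ← Units.val_pow_eq_pow_val, Int.units_sq]
    simp
  have ha0 : a ≠ 0 := by
    rintro rfl
    rw [map_zero] at ha
    exact h0 (pow_eq_zero_iff two_ne_zero |>.1 ha.symm)
  exact ⟨Units.mk0 a ha0, ha⟩

variable [Invertible (2 : k)]

/-- If `δ ^ 2 = a` and `G` acts on `δ` through the sign character `ε`, then the trace form attached
to the two-point set of `ε` is `⟨2⟩ ⊥ ⟨2a⟩`, the form of `k[X]/(X² - a)`. -/
theorem classHom_signSet (h0 : δ ≠ 0) (hδ : ∀ σ : L ≃ₐ[k] L, σ δ = ((ε σ : ℤ) : L) * δ)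
    {a : kˣ} (ha : algebraMap k L a = δ ^ 2) :
    classHom k L (signSet ε).toClass =
      rankOne k (unitOfInvertible 2) * (1 + rankOne k a) := by
  have h2 : (2 : L) ≠ 0 := two_ne_zero_of_algebra k L
  let p := signSet.mk ε 1
  let q := signSet.mk ε (-1)
  have hswap (σ : L ≃ₐ[k] L) :
      ε σ = 1 ∧ σ • p = p ∧ σ • q = q ∨ ε σ = -1 ∧ σ • p = q ∧ σ • q = p := by
    obtain h1 | h1 := Int.units_eq_one_or (ε σ) <;> simp [signSet.smul_mk, h1, p, q]
  let F : equivariantMaps k L (signSet ε).carrier :=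
    ⟨fun x => ((signSet.val x : ℤ) : L) * δ, fun σ x => by
    beta_reduce
    rw [signSet.val_smul, map_mul, map_intCast, hδ]
    push_cast
    ring⟩
  have hFp : F.1 p = δ := by simp [F, p]
  have hFq : F.1 q = -δ := by simp [F, q]
  let f : k × k →ₗ[k] equivariantMaps k L (signSet ε).carrier :=
    (LinearMap.toSpanSingleton k _ 1).coprod (LinearMap.toSpanSingleton k _ F)
  have hf (z : k × k) (x : (signSet ε).carrier) :
      (f z).1 x = algebraMap k L z.1 + algebraMap k L z.2 * F.1 x := by
    simp [f, Algebra.smul_def]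
  have hinj : Function.Injective f := by
    refine (injective_iff_map_eq_zero f).2 fun z hz => ?_
    have e1 : (f z).1 p = 0 := by rw [hz]; rfl
    have e2 : (f z).1 q = 0 := by rw [hz]; rfl
    rw [hf, hFp] at e1
    rw [hf, hFq] at e2
    refine Prod.ext ((map_eq_zero (algebraMap k L)).1 ?_) ((map_eq_zero (algebraMap k L)).1 ?_)
    · have : 2 * algebraMap k L z.1 = 0 := by linear_combination e1 + e2
      simpa [h2] using this
    · have : 2 * δ * algebraMap k L z.2 = 0 := by linear_combination e1 - e2
      simpa [h2, h0] using this
  have hsurj : Function.Surjective f := by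
    intro g
    obtain ⟨x, hx⟩ := (IsGalois.mem_range_algebraMap_iff_fixed (F := k) ((g.1 p + g.1 q) / 2)).2
      fun σ => by
        obtain ⟨-, h1, h2⟩ | ⟨-, h1, h2⟩ := hswap σ <;>
        rw [map_div₀, map_add, ← equivariantMaps_apply, ← equivariantMaps_apply, h1, h2,
          map_ofNat]
        rw [add_comm]
    obtain ⟨y, hy⟩ := (IsGalois.mem_range_algebraMap_iff_fixed (F := k)
      ((g.1 p - g.1 q) / (2 * δ))).2 fun σ => by
        obtain ⟨h3, h1, h2⟩ | ⟨h3, h1, h2⟩ := hswap σ <;>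
        rw [map_div₀, map_sub, ← equivariantMaps_apply, ← equivariantMaps_apply, h1, h2,
          map_mul, map_ofNat, hδ, h3] <;> push_cast
        · rw [one_mul]
        · rw [← neg_sub, neg_one_mul, mul_neg, neg_div_neg_eq]
    refine ⟨(x, y), Subtype.ext (funext fun z => ?_)⟩
    rw [hf, hx, hy]
    obtain rfl | rfl := signSet.eq_one_or_neg_one z
    · erw [hFp]
      field_simp
      ring
    · erw [hFq]
      field_simp
      ring
  rw [mul_add, mul_one, ← map_mul]
  refine Eq.trans ?_ (toClass_add (nondegenerate_smul_sq _) (nondegenerate_smul_sq _)).symm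
  refine (toClass_eq_of_linearEquiv (hQ' := nondegenerate_equivariantMaps)
    (LinearEquiv.ofBijective f ⟨hinj, hsurj⟩) fun z => (algebraMap k L).injective ?_).symm
  rw [traceQuadraticForm_apply, algebraMap_trace, signSet.sum_eq]
  change (f z).1 p * (f z).1 p + (f z).1 q * (f z).1 q = _
  rw [hf, hf, hFp, hFq]
  simp only [prod_apply, smul_apply, sq_apply, smul_eq_mul, map_add, map_mul, Units.val_mul, ha,
    val_unitOfInvertible]
  linear_combination (-(algebraMap k L z.1 ^ 2 + algebraMap k L z.2 ^ 2 * δ ^ 2)) *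
    map_ofNat (algebraMap k L) 2

end

end Dress

namespace Dress

open QForm FinGSet GrothendieckRing

section

variable {k : Type u} {L : Type v} [Field k] [Field L] [Algebra k L] [FiniteDimensional k L]
  [IsGalois k L] [Invertible (2 : k)]

/-! ### Torsion in the image of the Dress map -/

theorem dressMap_of (X : IsoClass (L ≃ₐ[k] L)) :
    dressMap k L (of _ X) = of _ (classHom k L X) :=
  map_of _ _

/-- The Burnside ring is torsion-free, as is seen on marks; hence the Dress map is not injective
if two elements with different marks have images whose difference is torsion. -/
theorem not_injective_dressMap (U : Subgroup (L ≃ₐ[k] L)) {X Y : IsoClass (L ≃ₐ[k] L)}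
    (hm : mark U X ≠ mark U Y) {N : ℕ} (hN : N ≠ 0)
    (h : (N : IsometryClass k) * classHom k L X = N * classHom k L Y) :
    ¬ Function.Injective (dressMap k L) := by
  intro hinj
  have h1 : of _ (N * X) = of _ (N * Y) := hinj (by
    rw [dressMap_of, dressMap_of, map_mul (classHom k L), map_mul (classHom k L), map_natCast, h])
  have h2 := congrArg
    (Algebra.GrothendieckAddGroup.lift ((Nat.castAddMonoidHom ℤ).comp (mark U))) h1
  rw [lift_of, lift_of, ← nsmul_eq_mul, ← nsmul_eq_mul, map_nsmul, map_nsmul, nsmul_eq_mul,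
    nsmul_eq_mul] at h2
  have h3 : (mark U X : ℤ) = mark U Y := mul_left_cancel₀ (Nat.cast_ne_zero.2 hN) h2
  exact hm (Nat.cast_injective h3)

theorem classHom_coset_eq_sum (V : Subgroup (L ≃ₐ[k] L)) :
    ∃ w : Fin V.index → kˣ, classHom k L (coset V).toClass = ∑ i, rankOne k (w i) := by
  have h : Module.finrank k (equivariantMaps k L ((L ≃ₐ[k] L) ⧸ V)) = V.index := by
    rw [(cosetEquiv V).toLinearEquiv.finrank_eq, IntermediateField.finrank_eq_fixingSubgroup_index,
      IntermediateField.fixingSubgroup_fixedField]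
  rw [← h]
  exact toClass_eq_sum_rankOne _ nondegenerate_equivariantMaps

/-- Suppose that `U ≠ 1` and `V` have coprime orders and that `V` has odd index. Then
`x = |U| [G/U] - [G]` is killed by `[G/V]`, whose image is a sum of an odd number of elements of
square `1`. So the image of `x` is torsion. -/
theorem not_injective_of_coprime {U V : Subgroup (L ≃ₐ[k] L)} (hU : U ≠ ⊥)
    (hUV : (Nat.card U).Coprime (Nat.card V)) (hV : Odd V.index) :
    ¬ Function.Injective (dressMap k L) := by
  obtain ⟨w, hw⟩ := classHom_coset_eq_sum V
  let c := ofHom _ (classHom k L (Nat.card U * (coset U).toClass)) -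
    ofHom _ (classHom k L (coset (⊥ : Subgroup (L ≃ₐ[k] L))).toClass)
  have hc : (∑ i, ofHom _ (rankOne k (w i))) * c = (0 : ℤ) * c := by
    rw [← map_sum, ← hw, Int.cast_zero, zero_mul, mul_sub, ← map_mul, ← map_mul, ← map_mul,
      ← map_mul, mul_comm (coset V).toClass, mul_comm (coset V).toClass,
      card_mul_toClass_coset_mul U V hUV, sub_self]
  obtain ⟨N, hN, hNc⟩ := GrothendieckRing.exists_nsmul_eq_zero _ (fun i => by
    rw [← map_mul, rankOne_mul_self, map_one]) 0 (by simpa using hV) c hc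
  rw [mul_sub, sub_eq_zero, ← map_natCast (ofHom (IsometryClass k)), ← map_mul, ← map_mul] at hNc
  refine not_injective_dressMap U ?_ hN (of_injective hNc)
  rw [mark_coset_bot hU, ← nsmul_eq_mul, map_nsmul]
  exact smul_ne_zero Nat.card_pos.ne' (mark_coset_self_ne_zero U)

theorem mark_top_signSet {G : Type v} [Group G] {ε : G →* ℤˣ} (hε : ε ≠ 1) :
    mark ⊤ (signSet ε).toClass = 0 := by
  obtain ⟨g, hg⟩ := DFunLike.ne_iff.1 hε
  exact mark_eq_zero fun x => ⟨g, Subgroup.mem_top g, signSet.smul_ne hg x⟩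

theorem mark_two {G : Type v} [Group G] (U : Subgroup G) : mark U 2 = 2 := by
  rw [← one_add_one_eq_two, map_add, mark_one]

/-- If a quadratic extension `k(√a)` inside `L` is generated by the root of a sum of squares, then
`2 - [S]`, with `S` its two-point set, has torsion image. -/
theorem not_injective_of_isSumSq {ε : (L ≃ₐ[k] L) →* ℤˣ} (hε : ε ≠ 1) {δ : L} (h0 : δ ≠ 0)
    (hδ : ∀ σ : L ≃ₐ[k] L, σ δ = ((ε σ : ℤ) : L) * δ) {a : kˣ} (ha : algebraMap k L a = δ ^ 2)
    (hs : IsSumSq (a : k)) : ¬ Function.Injective (dressMap k L) := by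
  obtain ⟨m, hm⟩ := exists_two_pow_mul_rankOne_eq hs a rfl
  refine not_injective_dressMap ⊤ (X := 2) (Y := (signSet ε).toClass) ?_
    (pow_ne_zero (m + 1) two_ne_zero) ?_
  · rw [mark_top_signSet hε, mark_two]
    exact two_ne_zero
  rw [classHom_signSet h0 hδ ha, map_ofNat]
  push_cast
  symm
  calc (2 : IsometryClass k) ^ (m + 1) * (rankOne k (unitOfInvertible 2) * (1 + rankOne k a))
      = (2 * rankOne k (unitOfInvertible 2)) * (2 ^ m + 2 ^ m * rankOne k a) := by ring
    _ = 2 ^ (m + 1) * 2 := by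
      rw [hm, two_mul_rankOne_two]
      ring

/-- For two distinct quadratic characters `ε`, `ε'` with two-point sets `S`, `S'`, the element
`[S] + [S'] + [S''] - [S][S'] - 2`, where `S''` belongs to `εε'`, has torsion image. -/
theorem not_injective_of_ne {ε ε' : (L ≃ₐ[k] L) →* ℤˣ} (hε : ε ≠ 1) (hε' : ε' ≠ 1)
    (hne : ε ≠ ε') : ¬ Function.Injective (dressMap k L) := by
  obtain ⟨δ, h0, hδ⟩ := exists_signEigenvector ε
  obtain ⟨δ', h0', hδ'⟩ := exists_signEigenvector ε'
  obtain ⟨a, ha⟩ := exists_algebraMap_eq_sq h0 hδ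
  obtain ⟨a', ha'⟩ := exists_algebraMap_eq_sq h0' hδ'
  have hδδ (σ : L ≃ₐ[k] L) : σ (δ * δ') = (((ε * ε') σ : ℤ) : L) * (δ * δ') := by
    rw [map_mul, hδ, hδ', MonoidHom.mul_apply]
    push_cast
    ring
  have haa : algebraMap k L (a * a' : kˣ) = (δ * δ') ^ 2 := by
    rw [Units.val_mul, map_mul, ha, ha', mul_pow]
  have hεε : ε * ε' ≠ 1 := fun h => hne (MonoidHom.ext fun σ => by
    have := DFunLike.congr_fun h σ
    rw [MonoidHom.mul_apply, MonoidHom.one_apply, mul_eq_one_iff_eq_inv, Int.units_inv_eq_self]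
      at this
    exact this)
  refine not_injective_dressMap ⊤
    (X := (signSet ε).toClass + (signSet ε').toClass + (signSet (ε * ε')).toClass)
    (Y := (signSet ε).toClass * (signSet ε').toClass + 2) ?_ two_ne_zero ?_
  · have : mark ⊤ ((signSet ε).toClass * (signSet ε').toClass) = 0 := by
      obtain ⟨g, hg⟩ := DFunLike.ne_iff.1 hε
      exact mark_eq_zero (X := (signSet ε).prod (signSet ε')) fun x =>
        ⟨g, Subgroup.mem_top g, fun h => signSet.smul_ne hg x.1 (congrArg Prod.fst h)⟩
    rw [map_add, map_add, map_add, this, mark_top_signSet hε, mark_top_signSet hε',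
      mark_top_signSet hεε, mark_two]
    decide
  rw [map_add, map_add, map_add, map_mul, classHom_signSet h0 hδ ha, classHom_signSet h0' hδ' ha',
    classHom_signSet (mul_ne_zero h0 h0') hδδ haa, map_ofNat, map_mul]
  have h2 := two_mul_rankOne_two (k := k)
  have h22 := rankOne_mul_self (unitOfInvertible (2 : k))
  generalize rankOne k (unitOfInvertible 2) = t at *
  generalize rankOne k a = r at *
  generalize rankOne k a' = r' at *
  push_cast
  calc 2 * (t * (1 + r) + t * (1 + r') + t * (1 + r * r'))
      = (2 * t) * (3 + r + r' + r * r') := by ring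
    _ = 2 * (1 + r) * (1 + r') + 2 * 2 := by
      rw [h2]
      ring
    _ = 2 * (t * t * ((1 + r) * (1 + r')) + 2) := by
      rw [h22]
      ring
    _ = _ := by ring

/-! ### Reduction to quadratic extensions -/

/-- A quadratic extension `k(√a)` that embeds in a cyclic extension of degree divisible by `4` is
generated by the root of a sum of squares. -/
theorem exists_isSumSq_of_cyclic {ε : (L ≃ₐ[k] L) →* ℤˣ} {g : L ≃ₐ[k] L}
    (hg : Subgroup.zpowers g = ⊤) (hε : ε g = -1) (h4 : 4 ∣ orderOf g) :
    ∃ (δ : L) (a : kˣ), δ ≠ 0 ∧ (∀ σ : L ≃ₐ[k] L, σ δ = ((ε σ : ℤ) : L) * δ) ∧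
      algebraMap k L a = δ ^ 2 ∧ IsSumSq (a : k) := by
  have hfix {x : L} (hx : g x = x) (σ : L ≃ₐ[k] L) : σ x = x := by
    have : Subgroup.zpowers g ≤ MulAction.stabilizer (L ≃ₐ[k] L) x := by
      rw [Subgroup.zpowers_le]
      exact hx
    exact this (hg ▸ Subgroup.mem_top σ)
  -- an element `θ ≠ 0` of the cyclic quartic extension with `g² θ = -θ`
  obtain ⟨θ, hθ0, hθ⟩ : ∃ θ : L, θ ≠ 0 ∧ g (g θ) = -θ := by
    have hmem : g ^ 2 ∉ Subgroup.zpowers (g ^ 4) := by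
      rintro ⟨n, hn⟩
      have h1 : g ^ (4 * n - 2) = 1 := by
        rw [zpow_sub, zpow_mul]
        have : (g ^ 4) ^ n = g ^ 2 := hn
        exact_mod_cast mul_inv_eq_one.2 this
      have h2 := (Int.natCast_dvd_natCast.2 h4).trans (orderOf_dvd_iff_zpow_eq_one.2 h1)
      push_cast at h2
      omega
    rw [← IntermediateField.fixingSubgroup_fixedField (Subgroup.zpowers (g ^ 4)),
      IntermediateField.mem_fixingSubgroup_iff] at hmem
    push Not at hmem
    obtain ⟨z, hz, hz2⟩ := hmem
    have hz4 : (g ^ 4) z = z :=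
      (IntermediateField.mem_fixedField_iff _ _).1 hz _ (Subgroup.mem_zpowers _)
    simp only [pow_succ, pow_zero, one_mul, AlgEquiv.mul_apply] at hz2 hz4
    refine ⟨z - g (g z), sub_ne_zero.2 (Ne.symm hz2), ?_⟩
    rw [map_sub, map_sub, hz4, neg_sub]
  have h2 : (2 : L) ≠ 0 := two_ne_zero_of_algebra k L
  set δ := θ * g θ with hδdef
  have hδ0 : δ ≠ 0 := mul_ne_zero hθ0 ((map_ne_zero g).2 hθ0)
  have hgδ : g δ = -δ := by
    rw [hδdef, map_mul, hθ]
    ring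
  have hδ (σ : L ≃ₐ[k] L) : σ δ = ((ε σ : ℤ) : L) * δ := by
    obtain ⟨δ₁, h1, h1δ⟩ := exists_signEigenvector ε
    have hq := hfix (x := δ / δ₁) (by
      rw [map_div₀, hgδ, h1δ, hε]
      simp) σ
    rw [map_div₀, h1δ, div_eq_div_iff _ h1] at hq
    · refine mul_right_cancel₀ h1 ?_
      rw [hq]
      ring
    · rw [← h1δ]
      exact (map_ne_zero σ).2 h1
  obtain ⟨a, ha⟩ := exists_algebraMap_eq_sq hδ0 hδ
  refine ⟨δ, a, hδ0, hδ, ha, ?_⟩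
  -- write `θ² = x + yδ`; its norm `δ² = a` is `x² - ay²`
  obtain ⟨x, hx⟩ := (IsGalois.mem_range_algebraMap_iff_fixed (F := k)
    ((θ ^ 2 + g θ ^ 2) / 2)).2 (hfix (by
      rw [map_div₀, map_add, map_pow, map_pow, hθ, map_ofNat]
      ring))
  obtain ⟨y, hy⟩ := (IsGalois.mem_range_algebraMap_iff_fixed (F := k)
    ((θ ^ 2 - g θ ^ 2) / (2 * δ))).2 (hfix (by
      rw [map_div₀, map_sub, map_pow, map_pow, hθ, map_mul, map_ofNat, hgδ, mul_neg, div_neg,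
        ← neg_div]
      ring))
  have hxy : (a : k) * (1 + y ^ 2) = x ^ 2 := by
    refine (algebraMap k L).injective ?_
    rw [map_mul, map_add, map_one, map_pow, map_pow, hx, hy, ha]
    field_simp
    rw [hδdef]
    ring
  by_cases h : 1 + y ^ 2 = 0
  · have h2 : (2 : k) ≠ 0 := Invertible.ne_zero 2
    have : (a : k) = ((a + 1) / 2) * ((a + 1) / 2) + (y * (a - 1) / 2) * (y * (a - 1) / 2) := by
      field_simp
      linear_combination (-((a : k) - 1) ^ 2) * h
    rw [this]
    exact (IsSumSq.mul_self _).add (IsSumSq.mul_self _)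
  · have : (a : k) = (x / (1 + y ^ 2)) * (x / (1 + y ^ 2)) +
        (x * y / (1 + y ^ 2)) * (x * y / (1 + y ^ 2)) := by
      field_simp
      linear_combination hxy
    rw [this]
    exact (IsSumSq.mul_self _).add (IsSumSq.mul_self _)

/-- A proper subgroup of a finite `2`-group lies in the kernel of a nontrivial sign character. -/
theorem exists_signCharacter {G : Type*} [Group G] [Finite G] {n : ℕ} (hG : Nat.card G = 2 ^ n)
    {H : Subgroup G} (hH : H ≠ ⊤) : ∃ ε : G →* ℤˣ, ε ≠ 1 ∧ ∀ h ∈ H, ε h = 1 := by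
  classical
  have : Fact (Nat.Prime 2) := ⟨Nat.prime_two⟩
  obtain ⟨m, hm, hHm⟩ := (Nat.dvd_prime_pow Nat.prime_two).1 (hG ▸ H.card_subgroup_dvd_card)
  have hmn : m ≠ n := fun h => hH (Subgroup.eq_top_of_card_eq H (by rw [hHm, hG, h]))
  obtain ⟨K, hK, hHK⟩ := Sylow.exists_subgroup_card_pow_prime_le 2
    (m := n - 1) (hG ▸ pow_dvd_pow 2 (Nat.sub_le n 1)) H hHm (by omega)
  have hK2 : K.index = 2 := by
    have := K.card_mul_index
    obtain ⟨n, rfl⟩ : ∃ i, n = i + 1 := ⟨n - 1, by omega⟩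
    rw [hK, hG, Nat.add_sub_cancel, pow_succ] at this
    exact Nat.eq_of_mul_eq_mul_left (by positivity) this
  let ε : G →* ℤˣ :=
    { toFun := fun g => if g ∈ K then 1 else -1
      map_one' := if_pos K.one_mem
      map_mul' := fun g h => by
        by_cases h1 : g ∈ K <;> by_cases h2 : h ∈ K <;>
          simp [Subgroup.mul_mem_iff_of_index_two hK2, h1, h2] }
  refine ⟨ε, fun h => ?_, fun h hh => if_pos (hHK hh)⟩
  have : K = ⊤ := (Subgroup.eq_top_iff' K).2 fun g => by
    by_contra hg
    have h1 : ε g = -1 := if_neg hg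
    rw [h, MonoidHom.one_apply] at h1
    exact absurd h1 (by decide)
  rw [this, Subgroup.index_top] at hK2
  omega

theorem card_eq_two_pow_of_injective (h : Function.Injective (dressMap k L)) :
    ∃ n, Nat.card (L ≃ₐ[k] L) = 2 ^ n := by
  have : Fact (Nat.Prime 2) := ⟨Nat.prime_two⟩
  refine ⟨_, Nat.eq_prime_pow_of_unique_prime_dvd Nat.card_pos.ne' fun {p} hp hpd => ?_⟩
  by_contra hp2
  have := Fact.mk hp
  obtain ⟨g, hg⟩ := exists_prime_orderOf_dvd_card' p hpd
  let V : Sylow 2 (L ≃ₐ[k] L) := default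
  refine not_injective_of_coprime (U := Subgroup.zpowers g) (V := V) ?_ ?_ ?_ h
  · rw [Subgroup.zpowers_ne_bot]
    rintro rfl
    exact hp.one_lt.ne (orderOf_one.symm.trans hg)
  · rw [Nat.card_zpowers, hg, V.card_eq_multiplicity]
    exact ((Nat.coprime_primes hp Nat.prime_two).2 hp2).pow_right _
  · exact Nat.not_even_iff_odd.1 fun he => V.not_dvd_index he.two_dvd

theorem exists_of_injective (hL : (⊥ : IntermediateField k L) ≠ ⊤)
    (h : Function.Injective (dressMap k L)) :
    ∃ α : kˣ, ¬ IsSumSq (α : k) ∧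
      ∃ s : L, s ^ 2 = algebraMap k L α ∧ IntermediateField.adjoin k {s} = ⊤ := by
  obtain ⟨n, hn⟩ := card_eq_two_pow_of_injective h
  have hbot : (⊥ : Subgroup (L ≃ₐ[k] L)) ≠ ⊤ := fun hb => hL (by
    have := congrArg IntermediateField.fixedField hb
    rw [IntermediateField.fixedField_bot, IsGalois.fixedField_top] at this
    exact this.symm)
  obtain ⟨ε, hε, -⟩ := exists_signCharacter hn hbot
  obtain ⟨g, hg⟩ := DFunLike.ne_iff.1 hε
  have hg1 : ε g = -1 := (Int.units_eq_one_or _).resolve_left hg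
  have hcyc : Subgroup.zpowers g = ⊤ := by
    by_contra hne
    obtain ⟨ε', hε', h'⟩ := exists_signCharacter hn hne
    exact not_injective_of_ne hε hε' (fun heq => hg (heq ▸ h' g (Subgroup.mem_zpowers g))) h
  have hg2 : g ^ 2 = 1 := by
    by_contra hg2
    have h4 : 4 ∣ orderOf g := by
      obtain ⟨m, -, hm⟩ := (Nat.dvd_prime_pow Nat.prime_two).1 (hn ▸ orderOf_dvd_natCard g)
      have : 2 ≤ m := by
        by_contra! hlt
        exact hg2 (orderOf_dvd_iff_pow_eq_one.1 (hm ▸ pow_dvd_pow 2 (by omega : m ≤ 1)))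
      exact hm ▸ pow_dvd_pow 2 this
    obtain ⟨δ, a, h0, hδ, ha, hs⟩ := exists_isSumSq_of_cyclic hcyc hg1 h4
    exact not_injective_of_isSumSq hε h0 hδ ha hs h
  obtain ⟨δ, h0, hδ⟩ := exists_signEigenvector ε
  obtain ⟨a, ha⟩ := exists_algebraMap_eq_sq h0 hδ
  refine ⟨a, fun hs => not_injective_of_isSumSq hε h0 hδ ha hs h, δ, ha.symm, ?_⟩
  rw [← IsGalois.fixedField_fixingSubgroup (IntermediateField.adjoin k {δ}),
    ← IntermediateField.fixedField_bot]
  congr 1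
  refine (Subgroup.eq_bot_iff_forall _).2 fun σ hσ => ?_
  have hσδ : σ δ = δ := (IntermediateField.mem_fixingSubgroup_iff _ _).1 hσ δ
    (IntermediateField.mem_adjoin_simple_self k δ)
  -- `σ` is `1` or `g`, and `g δ = -δ`
  obtain ⟨i, rfl⟩ : σ ∈ Subgroup.zpowers g := hcyc ▸ Subgroup.mem_top σ
  obtain ⟨j, rfl | rfl⟩ := Int.even_or_odd' i
  · change g ^ (2 * j) = 1
    rw [zpow_mul, zpow_ofNat, hg2, one_zpow]
  · exfalso
    have hgj : g ^ (2 * j + 1) = g := by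
      rw [zpow_add, zpow_mul, zpow_ofNat, hg2, one_zpow, one_mul, zpow_one]
    change (g ^ (2 * j + 1)) δ = δ at hσδ
    rw [hgj, hδ, hg1] at hσδ
    have h2 : (2 : L) ≠ 0 := two_ne_zero_of_algebra k L
    refine mul_ne_zero h2 h0 ?_
    push_cast at hσδ
    linear_combination -hσδ

/-! ### Injectivity for quadratic extensions -/

theorem exists_eq_natCast_add_mul_signSet {G : Type v} [Group G] {ε : G →* ℤˣ}
    (hε : Function.Bijective ε) (X : IsoClass G) :
    ∃ m n : ℕ, X = m + n * (signSet ε).toClass := by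
  have : Finite G := Finite.of_injective ε hε.1
  have hcard : Nat.card G = 2 := by
    rw [Nat.card_congr (Equiv.ofBijective ε hε), Nat.card_eq_fintype_card, Fintype.card_units_int]
  have := Fact.mk (hcard ▸ Nat.prime_two)
  obtain ⟨X, rfl⟩ := Quotient.exists_rep X
  have hX := toClass_mem (AddSubmonoid.closure {1, (signSet ε).toClass}) X fun x => by
    refine AddSubmonoid.subset_closure ?_
    obtain h | h := (MulAction.stabilizer G x).eq_bot_or_eq_top_of_prime_card
    · right
      rw [Set.mem_singleton_iff, ← toClass_coset_bot_eq_signSet hε]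
      congr
    · left
      rw [← toClass_coset_top]
      congr
  obtain ⟨m, n, h⟩ := (AddSubmonoid.mem_closure_pair _ _ _).1 hX
  refine ⟨m, n, ?_⟩
  rw [nsmul_one, nsmul_eq_mul] at h
  exact h.symm

/-- If `L = k(√a)` and `a` is not a sum of squares, then the Dress map is injective: a kernel
element `m - n[S]` leads to `2n⟨a⟩ = 2n⟨1⟩`, so that `n = 0` by Witt cancellation. -/
theorem injective_of_not_isSumSq {ε : (L ≃ₐ[k] L) →* ℤˣ} (hε : Function.Bijective ε) {δ : L}
    (h0 : δ ≠ 0) (hδ : ∀ σ : L ≃ₐ[k] L, σ δ = ((ε σ : ℤ) : L) * δ) {a : kˣ}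
    (ha : algebraMap k L a = δ ^ 2) (hs : ¬ IsSumSq (a : k)) :
    Function.Injective (dressMap k L) := by
  refine (injective_iff_map_eq_zero _).2 fun x hx => ?_
  obtain ⟨X, Y, rfl⟩ := exists_eq_of_sub_of x
  rw [map_sub, sub_eq_zero, dressMap_of, dressMap_of] at hx
  have hXY := GrothendieckRing.of_injective hx
  rw [sub_eq_zero]
  congr 1
  obtain ⟨m, n, rfl⟩ := exists_eq_natCast_add_mul_signSet hε X
  obtain ⟨m', n', rfl⟩ := exists_eq_natCast_add_mul_signSet hε Y
  have hr (m n : ℕ) : classHom k L (m + n * (signSet ε).toClass) =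
      m + n * (rankOne k (unitOfInvertible 2) * (1 + rankOne k a)) := by
    rw [map_add, map_mul, map_natCast, map_natCast, classHom_signSet h0 hδ ha]
  -- comparison of dimensions
  have hdim (m n : ℕ) : dim (classHom k L (m + n * (signSet ε).toClass)) = m + n * 2 := by
    rw [hr, mul_add, mul_one, ← map_mul, ← nsmul_eq_mul, ← nsmul_one m, map_add, map_nsmul,
      map_nsmul, map_add, dim_rankOne, dim_rankOne, ← map_one (rankOne k), dim_rankOne]
    simp
  have hd : m + n * 2 = m' + n' * 2 := by rw [← hdim, ← hdim, hXY]
  have key (m n m' n' : ℕ) (hd : m + n * 2 = m' + n' * 2) (hle : n ≤ n')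
      (hXY : classHom k L (m + n * (signSet ε).toClass) =
        classHom k L (m' + n' * (signSet ε).toClass)) : n = n' := by
    obtain ⟨c, rfl⟩ := Nat.exists_eq_add_of_le hle
    obtain rfl : m = m' + 2 * c := by omega
    rw [hr, hr] at hXY
    by_contra hc
    refine hs (isSumSq_of_nsmul_eq a (n := 2 * c) (by omega) ?_)
    have h2 := two_mul_rankOne_two (k := k)
    refine add_left_cancel (a := (2 * m' + n * (2 * (1 + rankOne k a)) + 2 * c :
      IsometryClass k)) ?_
    rw [nsmul_eq_mul, nsmul_eq_mul]
    push_cast at hXY ⊢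
    calc (2 * m' + n * (2 * (1 + rankOne k a)) + 2 * c + 2 * c * rankOne k a : IsometryClass k)
        = 2 * m' + (n + c) * (2 * (1 + rankOne k a)) := by ring
      _ = 2 * (m' + (n + c) * (rankOne k (unitOfInvertible 2) * (1 + rankOne k a))) := by
        nth_rw 2 [← h2]
        ring
      _ = 2 * (m' + 2 * c) + n * ((2 * rankOne k (unitOfInvertible 2)) * (1 + rankOne k a)) := by
        rw [← hXY]
        ring
      _ = _ := by
        rw [h2]
        ring
  obtain rfl : n = n' := (le_total n n').elim (fun h => key m n m' n' hd h hXY)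
    fun h => (key m' n' m n hd.symm h hXY.symm).symm
  obtain rfl : m = m' := by omega
  rfl

theorem injective_of_exists (hL : (⊥ : IntermediateField k L) ≠ ⊤) {α : kˣ}
    (hα : ¬ IsSumSq (α : k)) {s : L} (hs : s ^ 2 = algebraMap k L α)
    (hgen : IntermediateField.adjoin k {s} = ⊤) : Function.Injective (dressMap k L) := by
  classical
  have h2 : (2 : L) ≠ 0 := two_ne_zero_of_algebra k L
  have hs0 : s ≠ 0 := by
    rintro rfl
    rw [zero_pow two_ne_zero] at hs
    exact (map_ne_zero (algebraMap k L)).2 α.ne_zero hs.symm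
  have hss : s ≠ -s := fun h => mul_ne_zero h2 hs0 (by linear_combination h)
  have hσ (σ : L ≃ₐ[k] L) : σ s = s ∨ σ s = -s := by
    rw [← sq_eq_sq_iff_eq_or_eq_neg, ← map_pow, hs, AlgEquiv.commutes]
  have hext {σ τ : L ≃ₐ[k] L} (h : σ s = τ s) : σ = τ := by
    have hstab : Subgroup.zpowers (τ⁻¹ * σ) ≤ MulAction.stabilizer (L ≃ₐ[k] L) s := by
      rw [Subgroup.zpowers_le]
      change τ.symm (σ s) = s
      rw [h, AlgEquiv.symm_apply_apply]
    have hmem : τ⁻¹ * σ ∈ (IntermediateField.adjoin k {s}).fixingSubgroup :=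
      (IntermediateField.le_iff_le _ _).1 (IntermediateField.adjoin_simple_le_iff.2
        ((IntermediateField.mem_fixedField_iff _ _).2 fun ρ hρ => hstab hρ))
        (Subgroup.mem_zpowers _)
    rw [hgen, IntermediateField.fixingSubgroup_top, Subgroup.mem_bot] at hmem
    exact (inv_mul_eq_one.1 hmem).symm
  let ε : (L ≃ₐ[k] L) →* ℤˣ :=
    { toFun := fun σ => if σ s = s then 1 else -1
      map_one' := if_pos rfl
      map_mul' := fun σ τ => by
        rw [AlgEquiv.mul_apply]
        obtain h1 | h1 := hσ σ <;> obtain h2 | h2 := hσ τ <;> simp [h1, h2, hss.symm] }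
  have hδ (σ : L ≃ₐ[k] L) : σ s = ((ε σ : ℤ) : L) * s := by
    change σ s = (((if σ s = s then 1 else -1 : ℤˣ) : ℤ) : L) * s
    obtain h | h := hσ σ <;> simp [h, hss.symm]
  have hinj : Function.Injective ε := fun σ τ h => hext (by rw [hδ, hδ, h])
  refine injective_of_not_isSumSq ⟨hinj, fun u => ?_⟩ hs0 hδ hs.symm hα
  obtain rfl | rfl := Int.units_eq_one_or u
  · exact ⟨1, map_one ε⟩
  by_contra! hne
  -- otherwise `s` is fixed by the Galois group
  refine hL ?_
  rw [← hgen, eq_comm, IntermediateField.adjoin_simple_eq_bot_iff]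
  refine (IsGalois.mem_range_algebraMap_iff_fixed s).2 fun σ => ?_
  rw [hδ, (Int.units_eq_one_or (ε σ)).resolve_right (hne σ)]
  simp

end

end Dress

theorem theorem1p1 (k : Type u) (L : Type v) [Field k] [Field L] [Algebra k L]
    [Invertible (2 : k)] [FiniteDimensional k L] [IsGalois k L]
    (hL : (⊥ : IntermediateField k L) ≠ ⊤) :
    Function.Injective (dressMap k L) ↔
      ∃ α : kˣ, ¬ IsSumSq (α : k) ∧
        ∃ s : L, s ^ 2 = algebraMap k L α ∧ IntermediateField.adjoin k {s} = ⊤ :=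
  ⟨Dress.exists_of_injective hL, fun ⟨_, hα, _, hs, hgen⟩ =>
    Dress.injective_of_exists hL hα hs hgen⟩
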